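/- Let $\eta$ be a random variable with values in $\{1,2,\dots\}$, $p(k)=\Pr\{\eta=k\}$, and put $p_\tau=p(\tau)/\sum_{k\ge\tau}p(k)$ for $\tau\ge1$ (with $p_\tau=0$ if the denominator vanishes). Let $\Omega=\{(n,\tau):n\ge1,\ \tau\ge0\ \text{integers}\}\cup\{(0,0)\}$, where $n$ is the number of customers at a server and $\tau$ is the time already spent on the customer in service. *The network.* Let $M\ge1$ servers be given. The network is the discrete-time Markov chain on $\Omega^M$ with the following step. At each server with $n\ge1$ the elapsed service time $\tau$ increases by $1$. Then, independently at the different servers with $n\ge 1$, the customer in service leaves with probability $p_\tau$ ($\tau$ being the new value), and the server passes from $(n,\tau)$ to $(n-1,0)$. Every customer who has left chooses, independently, one of the $M$ servers with probability $1/M$ each, and joins the end of its queue, so that a server which receives $k$ customers passes from $(n,\tau)$ to $(n+k,\tau)$. *The discrete non-linear Markov process.* For a probability measure $\mu^T$ on $\Omega$ let $\phi^{T+1}(n,\tau)=\mu^T(n,\tau-1)$ for $n\ge1$, $\tau\ge1$, $\phi^{T+1}(n,0)=0$ for $n\ge1$, $\phi^{T+1}(0,0)=\mu^T(0,0)$;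 $\psi^{T+1}(n,\tau)=\phi^{T+1}(n,\tau)(1-p_\tau)$ for $n,\tau\ge1$, $\psi^{T+1}(n,0)=\sum_{\tau\ge1}\phi^{T+1}(n+1,\tau)p_\tau$ for $n\ge1$, $\psi^{T+1}(0,0)=\phi^{T+1}(0,0)+\sum_{\tau\ge1}\phi^{T+1}(1,\tau)p_\tau$; $\lambda(T+1)=\sum_{n\ge1}\sum_{\tau\ge1}\phi^{T+1}(n,\tau)p_\tau$; and $$\mu^{T+1}(n,\tau)=\sum_{k\ge0}\psi^{T+1}(n-k,\tau)\,e^{-\lambda(T+1)}\frac{\lambda(T+1)^k}{k!},$$ where $\psi^{T+1}$ is $0$ outside $\Omega$. Given $\mu^0=\nu$, this defines the states $\mu^t$, $t=0,1,2,\dots$. The non-linear Markov process started from $\nu$ is the time-inhomogeneous Markov chain on $\Omega$ with initial law $\nu$ whose step from time $T$ to time $T+1$ is: ageing and departure with probability $p_\tau$ exactly as for one server of the network, followed by the arrival of an independent Poisson number of customers of mean $\lambda(T+1)$. Its law at time $t$ is $\mu^t$. **Theorem.** Consider a sequence of networks with $M\to\infty$ servers and $N$ customers, $N/M\to\rho$,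 with initial states $\bar\nu_M$, that is, probability measures on $\Omega^M$ carried by configurations with $N$ customers in total. Suppose that each $\bar\nu_M$ is invariant under permutations of the servers, and that the laws under $\bar\nu_M$ of the empirical measures $\frac1M\sum_{i=1}^M\delta_{\omega_i}$ converge weakly, as probability measures on the space of probability measures on $\Omega$ (with the weak topology), to the point mass $\delta_\nu$, where $\nu$ is a probability measure on $\Omega$. Then for every $K\ge1$ and every $t\ge0$, as $M\to\infty$, 1. the joint law at time $t$ of the configurations of any $K$ distinct servers converges weakly to $\mu^t\times\dots\times\mu^t$ ($K$ factors), where $\mu^0=\nu$; 2. the joint law of the trajectories of these $K$ servers at the times $0,1,\dots,t$ converges weakly to the product of $K$ copies of the law of the trajectory at the times $0,1,\dots,t$ of the non-linear Markov process started from $\nu$. -/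

import Mathlib

open Filter Topology MeasureTheory ProbabilityTheory
open scoped ENNReal NNReal BoundedContinuousFunction

namespace ClosedNetwork

noncomputable section

/-- Configurations of one server: pairs `(n, τ)` with `n` the number of customers present and `τ`
the time already spent on the customer in service; if `n = 0` then `τ = 0` (idle server). -/
abbrev Server : Type := {w : ℕ × ℕ // w.1 = 0 → w.2 = 0}

instance (K t : ℕ) : OpensMeasurableSpace (Fin K → Fin t → Server) :=
  haveI : OpensMeasurableSpace (Fin t → Server) := inferInstance
  inferInstance

/-- The number of customers at a server. -/
def Server.queue (w : Server) : ℕ := w.1.1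

/-- The elapsed service time of the customer in service. -/
def Server.elapsed (w : Server) : ℕ := w.1.2

/-- One unit of time passes: `(n, τ) ↦ (n, τ + 1)` for `n ≥ 1`, and an idle server stays idle. -/
def Server.age (w : Server) : Server :=
  if h : w.queue = 0 then w else ⟨(w.queue, w.elapsed + 1), fun h' => absurd h' h⟩

/-- The customer in service leaves: `(n, τ) ↦ (n - 1, 0)`. -/
def Server.depart (w : Server) : Server := ⟨(w.queue - 1, 0), fun _ => rfl⟩

/-- `k` customers join the end of the queue: `(n, τ) ↦ (n + k, τ)`. -/
def Server.arrive (w : Server) (k : ℕ) : Server :=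
  ⟨(w.queue + k, w.elapsed), fun h => w.2 (Nat.eq_zero_of_add_eq_zero_right h)⟩

/-- The conditional probability `p(τ) / ∑_{k ≥ τ} p(k)` that a service ends at age exactly `τ`
given that it did not end earlier (equal to `0` where it is undefined, that is, for ages that a
service cannot reach). -/
def hazard (p : PMF ℕ) (τ : ℕ) : ℝ≥0∞ := p τ / ∑' k : Set.Ici τ, p k

theorem hazard_le_one (p : PMF ℕ) (τ : ℕ) : hazard p τ ≤ 1 := by
  refine ENNReal.div_le_of_le_mul ?_
  rw [one_mul]
  exact ENNReal.le_tsum (f := fun k : Set.Ici τ => p k) ⟨τ, Set.self_mem_Ici⟩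

/-- The probability that the customer in service leaves a server that has just been aged:
`p_τ` if `τ ≥ 1`; nobody leaves a server with `τ = 0`, which after ageing is an idle one. -/
def exitProb (p : PMF ℕ) (w : Server) : ℝ≥0∞ := if w.elapsed = 0 then 0 else hazard p w.elapsed

theorem exitProb_le_one (p : PMF ℕ) (w : Server) : exitProb p w ≤ 1 := by
  unfold exitProb
  split_ifs
  · exact zero_le_one
  · exact hazard_le_one p _

/-- The law of the indicator of a departure from an aged server. -/
def exitLaw (p : PMF ℕ) (w : Server) : PMF Bool :=
  PMF.ofFintype (fun b => if b then exitProb p w else 1 - exitProb p w) (by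
    simp [add_tsub_cancel_of_le (exitProb_le_one p w)])

/-- The law of an aged server after the possible departure. -/
def exitStep (p : PMF ℕ) (w : Server) : PMF Server :=
  (exitLaw p w).map fun b => if b then w.depart else w

/-- The law of a server after the arrival of a Poisson number of customers of mean `r`. -/
def arriveStep (r : ℝ≥0) (w : Server) : PMF Server :=
  (poissonMeasure r).toPMF.map w.arrive

/-! ### The non-linear Markov process -/

/-- The exit flow `∑ φ(n, τ) p_τ` of the state `μ`, where `φ` is the aged state. -/
def flow (p : PMF ℕ) (μ : PMF Server) : ℝ≥0 :=
  (∑' w, (μ.map Server.age) w * exitProb p w).toNNReal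

/-- One time step of the non-linear evolution: the vertical shift, the downward jump, and
convolution with the Poisson law whose mean is the exit flow. -/
def nmpStep (p : PMF ℕ) (μ : PMF Server) : PMF Server :=
  ((μ.map Server.age).bind (exitStep p)).bind (arriveStep (flow p μ))

/-- The state `μ^t` of the non-linear Markov process started from `ν`. -/
def nmpState (p : PMF ℕ) (ν : PMF Server) : ℕ → PMF Server
  | 0 => ν
  | t + 1 => nmpStep p (nmpState p ν t)

/-- The transition probabilities of the non-linear Markov process started from `ν`, from time `t`
to time `t + 1`: service as usual, and Poisson arrivals with the rate given by its own exit
flow at that time. -/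
def nmpKernel (p : PMF ℕ) (ν : PMF Server) (t : ℕ) (w : Server) : PMF Server :=
  (exitStep p w.age).bind (arriveStep (flow p (nmpState p ν t)))

/-! ### The network -/

/-- Independent departures: the law of the vector of departure indicators of `M` aged servers. -/
def departures (p : PMF ℕ) {M : ℕ} (ω : Fin M → Server) : PMF (Fin M → Bool) :=
  PMF.ofFintype (fun d => ∏ i, exitLaw p (ω i) (d i)) (by
    rw [← Fintype.piFinset_univ, ← Finset.prod_univ_sum]
    refine Finset.prod_eq_one fun i _ => ?_
    exact (tsum_fintype _).symm.trans (exitLaw p (ω i)).tsum_coe)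

/-- The configuration of the network after the step in which the customers in service at the
servers `i` with `d i = true` leave, and go to the servers `r i`. -/
def reroute {M : ℕ} (ω : Fin M → Server) (d : Fin M → Bool) (r : Fin M → Fin M) :
    Fin M → Server :=
  fun j => (if d j then (ω j).depart else ω j).arrive
    (Finset.univ.filter fun i => d i = true ∧ r i = j).card

/-- The transition probabilities of the network of `M` servers: all services get older by one,
each ends independently with its conditional probability, and each customer who leaves chooses
his next server independently and uniformly among all `M` servers. -/
def networkStep (p : PMF ℕ) {M : ℕ} (ω : Fin M → Server) : PMF (Fin M → Server) :=
  (departures p fun i => (ω i).age).bind fun d =>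
    haveI : Nonempty (Fin M → Fin M) := ⟨id⟩
    (PMF.uniformOfFintype (Fin M → Fin M)).map fun r => reroute (fun i => (ω i).age) d r

/-- The state of the network at time `t`, for the initial state `ν`. -/
def networkState (p : PMF ℕ) {M : ℕ} (ν : PMF (Fin M → Server)) : ℕ → PMF (Fin M → Server)
  | 0 => ν
  | t + 1 => (networkState p ν t).bind (networkStep p)

/-! ### Trajectories, symmetry, empirical measures -/

/-- The law of the trajectory at the times `0, …, t` of the (time-inhomogeneous) Markov chain
with initial law `ν` and transition probabilities `Q s` from time `s` to time `s + 1`. -/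
def pathLaw {S : Type*} (ν : PMF S) (Q : ℕ → S → PMF S) : (t : ℕ) → PMF (Fin (t + 1) → S)
  | 0 => ν.map fun x _ => x
  | t + 1 => (pathLaw ν Q t).bind fun x =>
      (Q t (x (Fin.last t))).map fun y => (Fin.snoc x y : Fin (t + 1 + 1) → S)

/-- A discrete law as a probability measure. -/
def toProb {S : Type*} [MeasurableSpace S] (μ : PMF S) : ProbabilityMeasure S :=
  ⟨μ.toMeasure, inferInstance⟩

/-- The law of `K` independent random elements with the same discrete law `μ`. -/
def prodLaw {S : Type*} [MeasurableSpace S] (K : ℕ) (μ : PMF S) :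
    ProbabilityMeasure (Fin K → S) :=
  ProbabilityMeasure.pi fun _ => toProb μ

/-- Invariance of a state of the network under permutations of the servers. -/
def ServerSymmetric {M : ℕ} (ν : PMF (Fin M → Server)) : Prop :=
  ∀ σ : Equiv.Perm (Fin M), ν.map (fun ω i => ω (σ i)) = ν

/-- The empirical measure `M⁻¹ ∑ δ_{ω i}` of a configuration. -/
def empirical {M : ℕ} [NeZero M] (ω : Fin M → Server) : ProbabilityMeasure Server :=
  ⟨(M : ℝ≥0∞)⁻¹ • ∑ i, Measure.dirac (ω i), ⟨by
    simp [ENNReal.inv_mul_cancel (Nat.cast_ne_zero.2 (NeZero.ne M)) (ENNReal.natCast_ne_top M)]⟩⟩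

/-- The law of large numbers: the laws of the empirical measures under the states `νbar m`, which
are probability measures on the space of probability measures (with the weak topology), converge
weakly to the point mass at `ν`. -/
def EmpiricalLLN (M : ℕ → ℕ) [∀ m, NeZero (M m)] (νbar : ∀ m, PMF (Fin (M m) → Server))
    (ν : PMF Server) : Prop :=
  ∀ F : ProbabilityMeasure Server →ᵇ ℝ,
    Tendsto (fun m => ∫ ω, F (empirical ω) ∂(νbar m).toMeasure) atTop (𝓝 (F (toProb ν)))

end

end ClosedNetwork

open ClosedNetwork

/-!
The proof is by propagation of chaos. `Chaotic p νbar ν t` says that the trajectories up to time `t`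
of any `K` distinct servers are asymptotically independent, each with the law of the trajectory of
the non-linear Markov process, uniformly in the choice of the servers. As the configuration spaces
are countable and discrete, weak convergence to a probability measure is convergence of the point
masses, and implies convergence of the integrals of all bounded functions (Scheffé's lemma).

At time `0` (`chaotic_zero`), under a symmetric law the configuration of `K` distinct servers differs
from `K` independent draws from the empirical measure only through draws with repetitions, whose
proportion tends to `0`; and the product of `K` point masses is a continuous function of the
empirical measure, to which the law of large numbers applies.

One step (`Chaotic.succ`) rests on two facts. The first, `abs_integral_networkStep_sub_le`, is
deterministic: from *every* configuration `ω`, the law of the next configuration of `K` given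
servers is within `O(1 / M)` of the product of the laws of service followed by Poisson arrivals
whose mean is the exit flow `meanExit p ω` of `ω`. It is Le Cam's theorem, proved by operators: let
`G` be the generator of independent Poisson arrivals at the `K` servers, acting on bounded functions
of the arrival counts, divided by `M`. A server from which a customer leaves with probability `q`
contributes the operator `1 + q G`, which is within `O(‖G‖ ^ 2) = O(1 / M ^ 2)` of `exp (q G)`.
All these operators commute and the `1 + q G` are contractions, so the product over the `M` servers
is within `O(1 / M)` of `exp (∑ q G)`, which averages over Poisson variables. The second,
`Chaotic.tendsto_meanExit`, is that the exit flow of the network converges in mean square to that of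
the non-linear process: it is an average of bounded functions of the single servers, nearly
uncorrelated by chaos for pairs. As the transition probabilities with Poisson arrivals are
continuous in the mean of the arrivals, the point masses of the trajectories converge at
time `t + 1` as well.
-/

namespace ClosedNetwork

noncomputable section

/-! ### Discrete laws -/

theorem toMeasure_real_singleton {S : Type*} [MeasurableSpace S] [MeasurableSingletonClass S]
    (μ : PMF S) (x : S) : μ.toMeasure.real {x} = (μ x).toReal := by
  rw [measureReal_def, PMF.toMeasure_apply_singleton _ _ (measurableSet_singleton _)]

theorem abs_integral_toMeasure_le {S : Type*} [MeasurableSpace S] (μ : PMF S)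
    {f : S → ℝ} {C : ℝ} (hf : ∀ x, |f x| ≤ C) :
    |∫ x, f x ∂μ.toMeasure| ≤ C := by
  have := norm_integral_le_of_norm_le_const (μ := μ.toMeasure) (f := f) (ae_of_all _ hf)
  simpa using this

section Discrete

variable {S T : Type*} [Countable S] [MeasurableSpace S] [MeasurableSingletonClass S]

theorem integrable_of_bound (μ : Measure S) [IsFiniteMeasure μ] {f : S → ℝ} {C : ℝ}
    (hf : ∀ x, |f x| ≤ C) : Integrable f μ :=
  Integrable.of_bound (.of_discrete) C (ae_of_all _ hf)

theorem hasSum_measureReal_singleton (μ : Measure S) [IsProbabilityMeasure μ] :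
    HasSum (fun x => μ.real {x}) 1 := by
  have h := ENNReal.hasSum_toReal (f := fun x => μ.toPMF x) (PMF.tsum_coe_ne_top _)
  rwa [← ENNReal.tsum_toReal_eq fun x => PMF.apply_ne_top _ x, PMF.tsum_coe] at h

/-- Scheffé's lemma on a countable space: if the point masses of probability measures converge to
those of a probability measure, then the integrals of all bounded functions converge. The sum of
the absolute differences is twice the sum of their negative parts, which are dominated by the
limit. -/
theorem tendsto_integral_of_tendsto_singleton {ι : Type*} {l : Filter ι} {P : ι → Measure S}
    [∀ i, IsProbabilityMeasure (P i)] {Q : Measure S} [IsProbabilityMeasure Q]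
    (h : ∀ x, Tendsto (fun i => (P i).real {x}) l (𝓝 (Q.real {x}))) {f : S → ℝ} {C : ℝ}
    (hf : ∀ x, |f x| ≤ C) :
    Tendsto (fun i => ∫ x, f x ∂(P i)) l (𝓝 (∫ x, f x ∂Q)) := by
  have hneg : Tendsto (fun i => ∑' x, max (Q.real {x} - (P i).real {x}) 0) l
      (𝓝 (∑' _ : S, (0 : ℝ))) := by
    refine tendsto_tsum_of_dominated_convergence (hasSum_measureReal_singleton Q).summable
      (fun x => ?_) (Eventually.of_forall fun i x => ?_)
    · have := ((tendsto_const_nhds (x := Q.real {x})).sub (h x)).max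
        (tendsto_const_nhds (x := (0 : ℝ)))
      simpa using this
    · rw [Real.norm_of_nonneg (le_max_right _ _)]
      exact max_le (sub_le_self _ measureReal_nonneg) measureReal_nonneg
  rw [tendsto_iff_norm_sub_tendsto_zero]
  refine squeeze_zero (fun _ => norm_nonneg _) (fun i => ?_) (by simpa using hneg.const_mul (C * 2))
  have sP := hasSum_measureReal_singleton (P i)
  have sQ := hasSum_measureReal_singleton Q
  -- `|a| = 2 a⁻ + a`, and the differences of the point masses add up to `0`
  have habs : ∀ x, |(P i).real {x} - Q.real {x}| =
      2 * max (Q.real {x} - (P i).real {x}) 0 + ((P i).real {x} - Q.real {x}) := fun x => by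
    rcases le_total (Q.real {x}) ((P i).real {x}) with hx | hx
    · rw [abs_of_nonneg (by linarith), max_eq_right (by linarith)]; ring
    · rw [abs_of_nonpos (by linarith), max_eq_left (by linarith)]; ring
  have smax : Summable fun x => max (Q.real {x} - (P i).real {x}) 0 :=
    Summable.of_nonneg_of_le (fun _ => le_max_right _ _)
      (fun x => max_le (sub_le_self _ measureReal_nonneg) measureReal_nonneg) sQ.summable
  have sabs : HasSum (fun x => |(P i).real {x} - Q.real {x}|)
      (2 * ∑' x, max (Q.real {x} - (P i).real {x}) 0) := by
    simp_rw [habs]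
    simpa using (smax.hasSum.mul_left 2).add (sP.sub sQ)
  have hbd : ∀ x, ‖((P i).real {x} - Q.real {x}) * f x‖ ≤ C * |(P i).real {x} - Q.real {x}| :=
    fun x => by
      rw [norm_mul, mul_comm, Real.norm_eq_abs, Real.norm_eq_abs]
      exact mul_le_mul_of_nonneg_right (hf x) (abs_nonneg _)
  have sdom := sabs.mul_left C
  have hs : ∀ (μ : Measure S) [IsProbabilityMeasure μ], Summable fun x => μ.real {x} * f x :=
    fun μ _ => ((hasSum_measureReal_singleton μ).summable.mul_left C).of_norm_bounded fun x => by
      rw [norm_mul, mul_comm, Real.norm_eq_abs, Real.norm_of_nonneg measureReal_nonneg]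
      exact mul_le_mul_of_nonneg_right (hf x) measureReal_nonneg
  have key : ∫ x, f x ∂(P i) - ∫ x, f x ∂Q = ∑' x, ((P i).real {x} - Q.real {x}) * f x := by
    rw [integral_countable (integrable_of_bound _ hf), integral_countable
      (integrable_of_bound _ hf)]
    simp only [smul_eq_mul, sub_mul]
    exact ((hs _).tsum_sub (hs _)).symm
  rw [key, mul_assoc, ← sdom.tsum_eq]
  exact tsum_of_norm_bounded sdom.summable.hasSum hbd

theorem tendsto_iff_tendsto_singleton [TopologicalSpace S] [DiscreteTopology S]
    [OpensMeasurableSpace S] {ι : Type*} {l : Filter ι} {P : ι → ProbabilityMeasure S}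
    {Q : ProbabilityMeasure S} :
    Tendsto P l (𝓝 Q) ↔
      ∀ x, Tendsto (fun i => (P i : Measure S).real {x}) l (𝓝 ((Q : Measure S).real {x})) := by
  rw [ProbabilityMeasure.tendsto_iff_forall_integral_tendsto]
  refine ⟨fun h x => ?_, fun h f => tendsto_integral_of_tendsto_singleton h (C := ‖f‖)
    fun x => f.norm_coe_le_norm x⟩
  have := h (BoundedContinuousFunction.ofNormedAddCommGroup (Set.indicator {x} 1)
    continuous_of_discreteTopology 1 fun y => by
      by_cases hy : y = x <;> simp [hy])
  simpa [integral_indicator_one] using this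

/-- Weak convergence gives convergence of the integrals of all bounded functions, which are
continuous on a discrete space. -/
theorem tendsto_integral_of_tendsto [TopologicalSpace S] [DiscreteTopology S]
    [OpensMeasurableSpace S] {ι : Type*} {l : Filter ι} {P : ι → ProbabilityMeasure S}
    {Q : ProbabilityMeasure S} (h : Tendsto P l (𝓝 Q)) {f : S → ℝ} {C : ℝ}
    (hf : ∀ x, |f x| ≤ C) :
    Tendsto (fun i => ∫ x, f x ∂(P i : Measure S)) l (𝓝 (∫ x, f x ∂(Q : Measure S))) :=
  tendsto_integral_of_tendsto_singleton (tendsto_iff_tendsto_singleton.1 h) hf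

theorem abs_integral_le_add_mul (P : Measure S) [IsProbabilityMeasure P] {A B : S → ℝ}
    {a b c C : ℝ} (hA : ∀ x, |A x| ≤ a) (hB : ∀ x, |B x| ≤ b) (h : ∀ x, |A x| ≤ c + C * B x) :
    |∫ x, A x ∂P| ≤ c + C * ∫ x, B x ∂P := by
  have hBi := (integrable_of_bound P hB).const_mul C
  calc |∫ x, A x ∂P| ≤ ∫ x, |A x| ∂P := abs_integral_le_integral_abs
    _ ≤ ∫ x, (c + C * B x) ∂P :=
        integral_mono (integrable_of_bound P hA).abs ((integrable_const c).add hBi) h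
    _ = c + C * ∫ x, B x ∂P := by
        rw [integral_add (integrable_const c) hBi, integral_const_mul]
        simp

/-- Weak law of large numbers in mean square, for bounded variables that are nearly uncorrelated. -/
theorem integral_sq_mean_le (P : Measure S) [IsProbabilityMeasure P] {n : ℕ} (hn : 0 < n)
    {g : Fin n → S → ℝ} (hg : ∀ i x, |g i x| ≤ 1) {ε : ℝ} (hε : 0 ≤ ε)
    (h : ∀ i j, i ≠ j → ∫ x, g i x * g j x ∂P ≤ ε) :
    ∫ x, ((∑ i, g i x) / n) ^ 2 ∂P ≤ ε + (n : ℝ)⁻¹ := by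
  have hn' : (0 : ℝ) < n := Nat.cast_pos.2 hn
  have hgg : ∀ i j x, |g i x * g j x| ≤ 1 := fun i j x => by
    rw [abs_mul]; exact mul_le_one₀ (hg i x) (abs_nonneg _) (hg j x)
  have hint : ∀ i j, Integrable (fun x => g i x * g j x) P := fun i j =>
    integrable_of_bound P (hgg i j)
  have hij : ∀ i j, ∫ x, g i x * g j x ∂P ≤ ε + if i = j then 1 else 0 := fun i j => by
    split_ifs with hne
    · have h1 : ‖∫ x, g i x * g j x ∂P‖ ≤ 1 * P.real Set.univ :=
        norm_integral_le_of_norm_le_const (ae_of_all _ (hgg i j))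
      rw [probReal_univ, mul_one, Real.norm_eq_abs] at h1
      linarith [le_abs_self (∫ x, g i x * g j x ∂P)]
    · rw [add_zero]
      exact h i j hne
  have hsq : ∀ x, ((∑ i, g i x) / n) ^ 2 = ((n : ℝ)⁻¹) ^ 2 * ∑ i, ∑ j, g i x * g j x := fun x => by
    rw [← Finset.sum_mul_sum, ← sq, ← mul_pow, div_eq_inv_mul]
  simp_rw [hsq]
  rw [integral_const_mul, integral_finsetSum _ fun i _ => integrable_finsetSum _ fun j _ => hint i j]
  simp_rw [integral_finsetSum _ fun j _ => hint _ j]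
  calc ((n : ℝ)⁻¹) ^ 2 * ∑ i, ∑ j, ∫ x, g i x * g j x ∂P
      ≤ ((n : ℝ)⁻¹) ^ 2 * ∑ i : Fin n, ∑ j, (ε + if i = j then 1 else 0) := by
        gcongr with i _ j _
        exact hij i j
    _ = ε + (n : ℝ)⁻¹ := by
        simp [Finset.sum_add_distrib]
        field_simp

variable [Countable T] [MeasurableSpace T] [MeasurableSingletonClass T]

theorem integral_toMeasure (μ : PMF S) {f : S → ℝ} {C : ℝ} (hf : ∀ x, |f x| ≤ C) :
    ∫ x, f x ∂μ.toMeasure = ∑' x, (μ x).toReal * f x :=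
  PMF.integral_eq_tsum _ _ (integrable_of_bound _ hf)

theorem integral_map_toMeasure (μ : PMF S) (g : S → T) (f : T → ℝ) :
    ∫ y, f y ∂(μ.map g).toMeasure = ∫ x, f (g x) ∂μ.toMeasure := by
  rw [← PMF.toMeasure_map (f := g) μ .of_discrete]
  exact integral_map .of_discrete .of_discrete

theorem integral_bind_toMeasure (μ : PMF S) (κ : S → PMF T) {f : T → ℝ} {C : ℝ}
    (hf : ∀ x, |f x| ≤ C) :
    ∫ y, f y ∂(μ.bind κ).toMeasure = ∫ x, ∫ y, f y ∂(κ x).toMeasure ∂μ.toMeasure := by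
  have hne : ∀ x y, μ x * κ x y ≠ ⊤ := fun x y =>
    ENNReal.mul_ne_top (μ.apply_ne_top x) ((κ x).apply_ne_top y)
  have hprod : ∑' z : S × T, μ z.1 * κ z.1 z.2 ≠ ⊤ := by
    rw [ENNReal.tsum_prod']
    simp [ENNReal.tsum_mul_left, PMF.tsum_coe]
  have hsum : Summable fun z : S × T => (μ z.1 * κ z.1 z.2).toReal * f z.2 := by
    refine ((ENNReal.summable_toReal hprod).mul_left C).of_norm_bounded fun z => ?_
    rw [norm_mul, mul_comm, Real.norm_eq_abs, Real.norm_of_nonneg ENNReal.toReal_nonneg]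
    exact mul_le_mul_of_nonneg_right (hf _) ENNReal.toReal_nonneg
  rw [integral_toMeasure _ hf, integral_toMeasure _ fun x => abs_integral_toMeasure_le (κ x) hf]
  calc ∑' y, ((μ.bind κ) y).toReal * f y
      = ∑' y, ∑' x, (μ x * κ x y).toReal * f y := tsum_congr fun y => by
        rw [PMF.bind_apply, ENNReal.tsum_toReal_eq fun x => hne x y, tsum_mul_right]
    _ = ∑' x, ∑' y, (μ x * κ x y).toReal * f y :=
        hsum.tsum_comm (f := fun x y => (μ x * κ x y).toReal * f y)
    _ = _ := tsum_congr fun x => by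
        simp_rw [integral_toMeasure _ hf, ENNReal.toReal_mul, mul_assoc, tsum_mul_left]

end Discrete

/-! ### Exponentials in a Banach algebra and Le Cam's telescoping -/

section Banach

variable {𝔸 : Type*} [NormedRing 𝔸] [NormedAlgebra ℝ 𝔸] [CompleteSpace 𝔸]

theorem exp_add_of_commute {x y : 𝔸} (hxy : Commute x y) :
    NormedSpace.exp (x + y) = NormedSpace.exp x * NormedSpace.exp y :=
  NormedSpace.exp_add_of_commute_of_mem_ball (𝕂 := ℝ) hxy
    ((NormedSpace.expSeries_radius_eq_top ℝ 𝔸).symm ▸ edist_lt_top _ _)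
    ((NormedSpace.expSeries_radius_eq_top ℝ 𝔸).symm ▸ edist_lt_top _ _)

theorem hasSum_exp_real (x : ℝ) :
    HasSum (fun n : ℕ => (n.factorial : ℝ)⁻¹ * x ^ n) (Real.exp x) := by
  have := NormedSpace.exp_series_hasSum_exp' (𝕂 := ℝ) x
  simpa [Real.exp_eq_exp_ℝ] using this

theorem norm_exp_sub_one_sub_le {x : 𝔸} (hx : ‖x‖ ≤ 1) :
    ‖NormedSpace.exp x - 1 - x‖ ≤ ‖x‖ ^ 2 := by
  have h1 := (hasSum_nat_add_iff' 2).2 (NormedSpace.exp_series_hasSum_exp' (𝕂 := ℝ) x)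
  have h2 := (hasSum_nat_add_iff' 2).2 (hasSum_exp_real ‖x‖)
  simp only [Finset.sum_range_succ, Finset.sum_range_zero, Nat.factorial, Nat.cast_one, inv_one,
    pow_zero, one_smul, zero_add, mul_one, pow_one, one_mul] at h1 h2
  rw [sub_sub, ← h1.tsum_eq]
  refine (tsum_of_norm_bounded h2 fun n => ?_).trans ?_
  · rw [norm_smul, norm_inv, Real.norm_natCast]
    exact mul_le_mul_of_nonneg_left (norm_pow_le' x (by omega)) (by positivity)
  · have := (abs_le.1 (Real.abs_exp_sub_one_sub_id_le (x := ‖x‖) (by simpa using hx))).2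
    linarith

/-- The hypothesis `h1` is weaker than `NormOneClass`: it also holds in the trivial algebra. -/
theorem norm_exp_le (h1 : ‖(1 : 𝔸)‖ ≤ 1) (x : 𝔸) : ‖NormedSpace.exp x‖ ≤ Real.exp ‖x‖ := by
  rw [← (NormedSpace.exp_series_hasSum_exp' (𝕂 := ℝ) x).tsum_eq]
  refine tsum_of_norm_bounded (hasSum_exp_real ‖x‖) fun n => ?_
  rw [norm_smul, norm_inv, Real.norm_natCast]
  refine mul_le_mul_of_nonneg_left ?_ (by positivity)
  rcases n.eq_zero_or_pos with rfl | hn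
  · simpa using h1
  · exact norm_pow_le' x hn

/-- The telescoping bound behind Le Cam's theorem: a product of contractions, each close to a
multiple of `exp (q i • g)`, is close to the corresponding multiple of `exp ((∑ q i) • g)`. The
factors are the images of commuting elements, so that their product makes sense without an order. -/
theorem norm_map_prod_sub_exp_le {A κ : Type*} [CommRing A] [DecidableEq κ] (φ : A →+* 𝔸)
    (a : κ → A) (c q δ : κ → ℝ) (g : 𝔸) {B : ℝ} (ha : ∀ i, ‖φ (a i)‖ ≤ 1)
    (hexp : ∀ s : Finset κ, ‖(∏ i ∈ s, c i) • NormedSpace.exp ((∑ i ∈ s, q i) • g)‖ ≤ B)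
    (hδ : ∀ i, ‖φ (a i) - c i • NormedSpace.exp (q i • g)‖ ≤ δ i) (s : Finset κ) :
    ‖φ (∏ i ∈ s, a i) - (∏ i ∈ s, c i) • NormedSpace.exp ((∑ i ∈ s, q i) • g)‖ ≤
      (∑ i ∈ s, δ i) * B := by
  induction s using Finset.induction_on with
  | empty => simp
  | insert j s hj ih =>
    rw [Finset.prod_insert hj, Finset.prod_insert hj, Finset.sum_insert hj, Finset.sum_insert hj,
      map_mul, add_smul, exp_add_of_commute (((Commute.refl g).smul_left _).smul_right _),
      ← smul_mul_smul_comm, add_mul]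
    set y := (∏ i ∈ s, c i) • NormedSpace.exp ((∑ i ∈ s, q i) • g)
    have : φ (a j) * φ (∏ i ∈ s, a i) - c j • NormedSpace.exp (q j • g) * y =
        (φ (a j) - c j • NormedSpace.exp (q j • g)) * y +
          φ (a j) * (φ (∏ i ∈ s, a i) - y) := by noncomm_ring
    rw [this]
    refine (norm_add_le _ _).trans (add_le_add ?_ ?_)
    · exact (norm_mul_le _ _).trans
        (mul_le_mul (hδ j) (hexp s) (norm_nonneg _) ((norm_nonneg _).trans (hδ j)))
    · exact (norm_mul_le _ _).trans
        ((mul_le_mul (ha j) ih (norm_nonneg _) zero_le_one).trans_eq (one_mul _))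

end Banach

/-! ### Shift operators and the Poisson semigroup -/

section Shift

variable {ι : Type*}

/-- The bounded functions of a vector of counters. A separate type, so that the operators on it
are found to form a Banach algebra. -/
def Observable (ι : Type*) : Type _ := (ι → ℕ) →ᵇ ℝ

instance : NormedAddCommGroup (Observable ι) := inferInstanceAs (NormedAddCommGroup ((ι → ℕ) →ᵇ ℝ))

instance : NormedSpace ℝ (Observable ι) := inferInstanceAs (NormedSpace ℝ ((ι → ℕ) →ᵇ ℝ))

instance : CompleteSpace (Observable ι) := inferInstanceAs (CompleteSpace ((ι → ℕ) →ᵇ ℝ))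

/-- The value of an observable at a vector of counters. -/
def evalAt (a : ι → ℕ) : Observable ι →L[ℝ] ℝ :=
  BoundedContinuousFunction.evalCLM (α := ι → ℕ) (β := ℝ) ℝ a

theorem abs_evalAt_le (a : ι → ℕ) (f : Observable ι) : |evalAt a f| ≤ ‖f‖ :=
  BoundedContinuousFunction.norm_coe_le_norm (α := ι → ℕ) (β := ℝ) f a

theorem Observable.ext {f g : Observable ι} (h : ∀ a, evalAt a f = evalAt a g) : f = g :=
  BoundedContinuousFunction.ext (α := ι → ℕ) (β := ℝ) h

/-- The shift `f ↦ f (· + v)` on bounded functions of a vector of counters. -/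
def shift (v : ι → ℕ) : Observable ι →L[ℝ] Observable ι :=
  LinearMap.mkContinuous
    { toFun := fun f => BoundedContinuousFunction.compContinuous (β := ℝ) f
        ⟨fun a : ι → ℕ => a + v, by fun_prop⟩
      map_add' := fun _ _ => rfl
      map_smul' := fun _ _ => rfl } 1 (fun f => by
        rw [one_mul]
        exact (BoundedContinuousFunction.norm_le (β := ℝ) (norm_nonneg _)).2 fun a =>
          abs_evalAt_le _ f)

@[simp] theorem evalAt_shift (v : ι → ℕ) (f : Observable ι) (a : ι → ℕ) :
    evalAt a (shift v f) = evalAt (a + v) f := rfl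

theorem norm_shift_le (v : ι → ℕ) : ‖shift v‖ ≤ 1 :=
  LinearMap.mkContinuous_norm_le _ zero_le_one _

/-- The shifts as a representation of the additive monoid of counters. -/
def shiftHom : Multiplicative (ι → ℕ) →* Observable ι →L[ℝ] Observable ι where
  toFun v := shift v.toAdd
  map_one' := ContinuousLinearMap.ext fun f => Observable.ext fun a => by simp
  map_mul' v w := ContinuousLinearMap.ext fun f => Observable.ext fun a => by
    simp [add_assoc]

theorem shiftHom_apply (v : Multiplicative (ι → ℕ)) : shiftHom v = shift v.toAdd := rfl

theorem shift_zero : shift (0 : ι → ℕ) = 1 := shiftHom.map_one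

theorem norm_one_le : ‖(1 : Observable ι →L[ℝ] Observable ι)‖ ≤ 1 := by
  rw [← shift_zero]
  exact norm_shift_le 0

theorem shift_add (v w : ι → ℕ) : shift (v + w) = shift v * shift w :=
  shiftHom.map_mul (.ofAdd v) (.ofAdd w)

theorem shift_pow (v : ι → ℕ) (n : ℕ) : shift v ^ n = shift (n • v) :=
  (map_pow shiftHom (.ofAdd v) n).symm

theorem commute_shift (v w : ι → ℕ) : Commute (shift v) (shift w) := by
  rw [Commute, SemiconjBy, ← shift_add, ← shift_add, add_comm]

/-- Arrivals at a single counter: the operator `exp (r (S - 1))`, with `S` a shift, averages over a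
Poisson number of mean `r` of shifts. -/
theorem exp_smul_shift_sub_one_apply (r : ℝ) (v : ι → ℕ) (f : Observable ι) (a : ι → ℕ) :
    evalAt a (NormedSpace.exp (r • (shift v - 1)) f) =
      ∑' n : ℕ, Real.exp (-r) * r ^ n / n.factorial * evalAt (a + n • v) f := by
  have h1 : r • (shift v - 1) =
      algebraMap ℝ (Observable ι →L[ℝ] Observable ι) (-r) + r • shift v := by
    rw [Algebra.algebraMap_eq_smul_one, neg_smul r, smul_sub]; abel
  rw [h1, exp_add_of_commute (Algebra.commutes _ _), ← NormedSpace.algebraMap_exp_comm,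
    Algebra.algebraMap_eq_smul_one, smul_mul_assoc, one_mul, ← Real.exp_eq_exp_ℝ]
  have h2 := ((NormedSpace.exp_series_hasSum_exp' (𝕂 := ℝ) (r • shift v)).mapL
    (ContinuousLinearMap.apply ℝ _ f)).mapL (evalAt a)
  have h3 := (h2.mul_left (Real.exp (-r))).tsum_eq
  simp only [smul_pow, shift_pow] at h3
  exact h3.symm.trans (tsum_congr fun n => by simp; ring)

variable [Fintype ι]

/-- The product function `a ↦ ∏ k, f k (a k)` of functions bounded by `1`. -/
def prodFun (f : ι → ℕ → ℝ) (hf : ∀ k n, |f k n| ≤ 1) : Observable ι :=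
  BoundedContinuousFunction.ofNormedAddCommGroup (fun a : ι → ℕ => ∏ k, f k (a k))
    continuous_of_discreteTopology 1 fun a => by
      rw [Real.norm_eq_abs, Finset.abs_prod]
      exact Finset.prod_le_one (fun _ _ => abs_nonneg _) fun k _ => hf k _

@[simp] theorem evalAt_prodFun (f : ι → ℕ → ℝ) (hf : ∀ k n, |f k n| ≤ 1) (a : ι → ℕ) :
    evalAt a (prodFun f hf) = ∏ k, f k (a k) := rfl

theorem norm_prodFun_le (f : ι → ℕ → ℝ) (hf : ∀ k n, |f k n| ≤ 1) : ‖prodFun f hf‖ ≤ 1 :=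
  BoundedContinuousFunction.norm_ofNormedAddCommGroup_le _ zero_le_one _

variable [DecidableEq ι]

/-- The generator of independent unit-rate Poisson arrivals at all the counters. -/
def generator (ι : Type*) [Fintype ι] [DecidableEq ι] :
    Observable ι →L[ℝ] Observable ι :=
  ∑ k : ι, (shift (Pi.single k 1) - 1)

theorem norm_generator_le : ‖generator ι‖ ≤ 2 * Fintype.card ι := by
  refine (norm_sum_le _ _).trans ((Finset.sum_le_card_nsmul _ _ 2 fun k _ => ?_).trans_eq ?_)
  · refine (norm_sub_le _ _).trans ?_
    have := norm_shift_le (Pi.single k 1 : ι → ℕ)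
    have := norm_one_le (ι := ι)
    linarith
  · simp [mul_comm]

/-- Independent arrivals at the counters in `s`, by induction on `s`. The value at a general `a` is
what the induction needs. -/
theorem exp_smul_sum_shift_sub_one_apply (r : ℝ) (f : ι → ℕ → ℝ) (hf : ∀ k n, |f k n| ≤ 1)
    (s : Finset ι) (a : ι → ℕ) :
    evalAt a (NormedSpace.exp (r • ∑ k ∈ s, (shift (Pi.single k 1) - 1)) (prodFun f hf)) =
      ∏ k, if k ∈ s then ∑' n : ℕ, Real.exp (-r) * r ^ n / n.factorial * f k (a k + n)
        else f k (a k) := by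
  induction s using Finset.induction_on generalizing a with
  | empty => simp
  | insert j s hj ih =>
    have hcomm : Commute (r • (shift (Pi.single j 1 : ι → ℕ) - 1))
        (r • ∑ k ∈ s, (shift (Pi.single k 1 : ι → ℕ) - 1)) := by
      refine ((Commute.sum_right _ _ _ fun k _ => ?_).smul_left _).smul_right _
      exact ((commute_shift _ _).sub_left (Commute.one_left _)).sub_right (Commute.one_right _)
    rw [Finset.sum_insert hj, smul_add, exp_add_of_commute hcomm, mul_apply_eq_comp,
      exp_smul_shift_sub_one_apply, Fintype.prod_eq_mul_prod_compl j,
      if_pos (Finset.mem_insert_self _ _), ← tsum_mul_right]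
    refine tsum_congr fun n => ?_
    rw [ih, Fintype.prod_eq_mul_prod_compl j, if_neg hj, mul_assoc]
    congr 2
    · simp
    · refine Finset.prod_congr rfl fun k hk => ?_
      have hkj : k ≠ j := by simpa using hk
      simp [hkj]

/-- The semigroup of the generator averages over independent Poisson numbers of arrivals. -/
theorem exp_smul_generator_apply_zero (r : ℝ) (f : ι → ℕ → ℝ) (hf : ∀ k n, |f k n| ≤ 1) :
    evalAt 0 (NormedSpace.exp (r • generator ι) (prodFun f hf)) =
      ∏ k, ∑' n : ℕ, Real.exp (-r) * r ^ n / n.factorial * f k n := by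
  rw [generator, exp_smul_sum_shift_sub_one_apply]
  simp

end Shift

/-! ### Poisson approximation of the arrivals -/

section Arrivals

variable {ι : Type*} {M : ℕ}

/-- The numbers of customers who arrive at the servers `e k`, when the customers of the servers `i`
with `d i = true` go to the servers `r i`. -/
def arrivals (e : ι → Fin M) (d : Fin M → Bool) (r : Fin M → Fin M) (k : ι) : ℕ :=
  (Finset.univ.filter fun i => d i = true ∧ r i = e k).card

/-- The contribution to the arrivals of a single server, with departure indicator `z.1` and
destination `z.2`. -/
def jump (e : ι → Fin M) (z : Bool × Fin M) (k : ι) : ℕ := if z.1 = true ∧ z.2 = e k then 1 else 0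

theorem sum_jump (e : ι → Fin M) (c : Fin M → Bool × Fin M) :
    ∑ i, jump e (c i) = arrivals e (fun i => (c i).1) (fun i => (c i).2) := by
  ext k
  simp [jump, arrivals, Finset.sum_apply]

theorem prod_single_addMonoidAlgebra {G κ : Type*} [AddCommMonoid G] (s : Finset κ) (v : κ → G)
    (w : κ → ℝ) :
    ∏ i ∈ s, (AddMonoidAlgebra.single (v i) (w i) : AddMonoidAlgebra ℝ G) =
      AddMonoidAlgebra.single (∑ i ∈ s, v i) (∏ i ∈ s, w i) := by
  classical
  induction s using Finset.induction_on with
  | empty => simp [AddMonoidAlgebra.one_def]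
  | insert j s hj ih =>
    rw [Finset.prod_insert hj, Finset.prod_insert hj, Finset.sum_insert hj, ih,
      AddMonoidAlgebra.single_mul_single]

/-- The representation of the group algebra of the counters by shift operators. -/
def shiftAlgHom (ι : Type*) :
    AddMonoidAlgebra ℝ (ι → ℕ) →ₐ[ℝ] Observable ι →L[ℝ] Observable ι :=
  AddMonoidAlgebra.lift ℝ _ (ι → ℕ) shiftHom

theorem shiftAlgHom_single (v : ι → ℕ) (w : ℝ) :
    shiftAlgHom ι (AddMonoidAlgebra.single v w) = w • shift v := by
  simp [shiftAlgHom, AddMonoidAlgebra.lift_single, shiftHom_apply]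

/-- The law of the jump of one server with (sub-)probabilities `m` of the departure indicator and
uniform destination, in the group algebra of the counters. -/
def jumpElt (e : ι → Fin M) (m : Bool → ℝ) : AddMonoidAlgebra ℝ (ι → ℕ) :=
  ∑ z : Bool × Fin M, AddMonoidAlgebra.single (jump e z) (m z.1 / M)

/-- Independence of the servers: the product of the laws of their jumps is the law of the arrivals. -/
theorem evalAt_shiftAlgHom_prod (e : ι → Fin M) (m : Fin M → Bool → ℝ) (f : Observable ι) :
    evalAt 0 (shiftAlgHom ι (∏ i, jumpElt e (m i)) f) =
      ∑ d : Fin M → Bool, ∑ r : Fin M → Fin M,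
        (∏ i, m i (d i) / M) * evalAt (arrivals e d r) f := by
  unfold jumpElt
  rw [Finset.prod_univ_sum, Fintype.piFinset_univ, map_sum, sum_apply, map_sum,
    ← Fintype.sum_prod_type', ← (Equiv.arrowProdEquivProdArrow (Fin M) (fun _ => Bool)
      (fun _ => Fin M)).sum_comp]
  refine Finset.sum_congr rfl fun c _ => ?_
  rw [prod_single_addMonoidAlgebra, sum_jump, shiftAlgHom_single]
  simp [Equiv.arrowProdEquivProdArrow]

theorem sum_jumpWeights [NeZero M] (m : Bool → ℝ) :
    ∑ z : Bool × Fin M, m z.1 / M = m true + m false := by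
  have hM : (M : ℝ) ≠ 0 := Nat.cast_ne_zero.2 (NeZero.ne M)
  rw [Fintype.sum_prod_type]
  simp
  field_simp

theorem norm_shiftAlgHom_jumpElt_le [NeZero M] (e : ι → Fin M) {m : Bool → ℝ}
    (hm : ∀ b, 0 ≤ m b) : ‖shiftAlgHom ι (jumpElt e m)‖ ≤ m true + m false := by
  rw [jumpElt, map_sum, ← sum_jumpWeights (M := M)]
  refine norm_sum_le_of_le _ fun z _ => ?_
  have h0 : 0 ≤ m z.1 / M := div_nonneg (hm _) (Nat.cast_nonneg _)
  rw [shiftAlgHom_single, norm_smul, Real.norm_of_nonneg h0]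
  exact mul_le_of_le_one_right h0 (norm_shift_le _)

variable [Fintype ι] [DecidableEq ι]

/-- A departing customer joins each of the distinct servers `e k` with probability `1 / M`. -/
theorem shiftAlgHom_jumpElt [NeZero M] {e : ι → Fin M} (he : Function.Injective e)
    (m : Bool → ℝ) :
    shiftAlgHom ι (jumpElt e m) =
      (m true + m false) • 1 + m true • (M : ℝ)⁻¹ • generator ι := by
  have hM : (M : ℝ) ≠ 0 := Nat.cast_ne_zero.2 (NeZero.ne M)
  have hfalse : ∀ r, jump e (false, r) = 0 := fun r => by ext k; simp [jump]
  have htrue : ∑ r, (shift (jump e (true, r)) - 1) = generator ι := by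
    refine (Fintype.sum_of_injective e he _ _ (fun r hr => ?_) fun k => ?_).symm
    · have : jump e (true, r) = 0 := by
        ext k
        have : r ≠ e k := fun h => hr ⟨k, h.symm⟩
        simp [jump, this]
      rw [this, shift_zero, sub_self]
    · -- no two of the servers `e k` coincide, so a customer arrives at one of them at most
      have : jump e (true, e k) = Pi.single k 1 := by
        ext l
        simp [jump, Pi.single_apply, he.eq_iff, eq_comm]
      rw [this]
  rw [← htrue, jumpElt, map_sum, Fintype.sum_prod_type, Fintype.sum_bool]
  simp only [shiftAlgHom_single, hfalse, shift_zero, ← Finset.smul_sum, Finset.sum_sub_distrib]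
  simp only [Finset.sum_const, Finset.card_univ, Fintype.card_fin, ← Nat.cast_smul_eq_nsmul ℝ,
    smul_sub, smul_smul, add_smul]
  have h2 : m true * (M : ℝ)⁻¹ * M = m true := by field_simp
  rw [mul_assoc] at h2
  simp only [h2, mul_assoc, div_eq_mul_inv]
  simp only [inv_mul_cancel₀ hM, mul_one]
  abel

/-- Le Cam's bound for the joint law of the arrivals at the servers `e k`, the departures being
weighted by sub-probabilities `m i`. Weights that are not those of departure with probability `q i`
serve to condition on the departures from the servers `e k`; they cost the last factor. -/
theorem abs_sum_arrivals_sub_le [NeZero M] {e : ι → Fin M} (he : Function.Injective e)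
    {m : Fin M → Bool → ℝ} (hm : ∀ i b, 0 ≤ m i b) (hm1 : ∀ i, m i true + m i false ≤ 1)
    {q : Fin M → ℝ} (hq : ∀ i, 0 ≤ q i) (hq1 : ∀ i, q i ≤ 1)
    (hK : 2 * (Fintype.card ι : ℝ) ≤ M) (f : Observable ι) :
    |∑ d : Fin M → Bool, ∑ r : Fin M → Fin M,
        (∏ i, m i (d i) / M) * evalAt (arrivals e d r) f -
      (∏ i, (m i true + m i false)) *
        evalAt 0 (NormedSpace.exp (((∑ i, q i) / M) • generator ι) f)| ≤
      (∑ i, ((2 * Fintype.card ι / M) ^ 2 +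
        |m i true - (m i true + m i false) * q i| * (2 * Fintype.card ι / M))) *
        Real.exp (2 * Fintype.card ι) * ‖f‖ := by
  have hM : (0 : ℝ) < M := Nat.cast_pos.2 (NeZero.pos M)
  set g : Observable ι →L[ℝ] Observable ι := (M : ℝ)⁻¹ • generator ι with hg
  set η : ℝ := 2 * Fintype.card ι / M with hη
  have hη0 : 0 ≤ η := by positivity
  have hη1 : η ≤ 1 := (div_le_one hM).2 hK
  have hgη : ‖g‖ ≤ η := by
    rw [hg, norm_smul, norm_inv, Real.norm_natCast, hη, div_eq_inv_mul]
    exact mul_le_mul_of_nonneg_left norm_generator_le (by positivity)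
  have hc0 : ∀ i, 0 ≤ m i true + m i false := fun i => add_nonneg (hm _ _) (hm _ _)
  have hexp : ∀ s : Finset (Fin M), ‖(∏ i ∈ s, (m i true + m i false)) •
      NormedSpace.exp ((∑ i ∈ s, q i) • g)‖ ≤ Real.exp (2 * Fintype.card ι) := fun s => by
    rw [norm_smul, Real.norm_of_nonneg (Finset.prod_nonneg fun i _ => hc0 i)]
    refine (mul_le_of_le_one_left (norm_nonneg _)
      (Finset.prod_le_one (fun i _ => hc0 i) fun i _ => hm1 i)).trans
      ((norm_exp_le norm_one_le _).trans (Real.exp_le_exp.2 ?_))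
    rw [norm_smul, Real.norm_of_nonneg (Finset.sum_nonneg fun i _ => hq i)]
    have hs : ∑ i ∈ s, q i ≤ M :=
      (Finset.sum_le_card_nsmul _ _ 1 fun i _ => hq1 i).trans (by
        simpa using (Nat.cast_le (α := ℝ)).2 (Finset.card_le_univ s))
    calc (∑ i ∈ s, q i) * ‖g‖ ≤ M * η :=
          mul_le_mul hs hgη (norm_nonneg _) hM.le
      _ = 2 * Fintype.card ι := by rw [hη]; field_simp
  have hδ : ∀ i, ‖(shiftAlgHom ι).toRingHom (jumpElt e (m i)) -
      (m i true + m i false) • NormedSpace.exp (q i • g)‖ ≤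
      η ^ 2 + |m i true - (m i true + m i false) * q i| * η := fun i => by
    have hqg : ‖q i • g‖ ≤ η := by
      rw [norm_smul, Real.norm_of_nonneg (hq i)]
      exact (mul_le_of_le_one_left (norm_nonneg _) (hq1 i)).trans hgη
    have h1 : (shiftAlgHom ι).toRingHom (jumpElt e (m i)) -
        (m i true + m i false) • NormedSpace.exp (q i • g) =
        -((m i true + m i false) • (NormedSpace.exp (q i • g) - 1 - q i • g)) +
          (m i true - (m i true + m i false) * q i) • g := by
      change shiftAlgHom ι (jumpElt e (m i)) - _ = _
      rw [shiftAlgHom_jumpElt he, ← hg]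
      module
    rw [h1]
    refine (norm_add_le _ _).trans (add_le_add ?_ ?_)
    · rw [norm_neg, norm_smul, Real.norm_of_nonneg (hc0 i)]
      refine (mul_le_of_le_one_left (norm_nonneg _) (hm1 i)).trans
        ((norm_exp_sub_one_sub_le (hqg.trans hη1)).trans ?_)
      gcongr
    · rw [norm_smul, Real.norm_eq_abs]
      gcongr
  have key := norm_map_prod_sub_exp_le (shiftAlgHom ι).toRingHom (fun i => jumpElt e (m i))
    (fun i => m i true + m i false) q _ g
    (fun i => (norm_shiftAlgHom_jumpElt_le e (hm i)).trans (hm1 i)) hexp hδ Finset.univ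
  have h2 : (∑ i, q i) • g = ((∑ i, q i) / M) • generator ι := by
    rw [hg, smul_smul, div_eq_mul_inv]
  rw [h2] at key
  rw [← evalAt_shiftAlgHom_prod]
  have h3 := (ContinuousLinearMap.le_opNorm _ f).trans
    (mul_le_mul_of_nonneg_right key (norm_nonneg f))
  refine le_trans ?_ ((abs_evalAt_le 0 _).trans h3)
  simp

end Arrivals

/-! ### One step of the network seen from finitely many servers -/

/-- The probability that the customer in service at a server leaves in the next step. -/
def exitRate (p : PMF ℕ) (w : Server) : ℝ≥0 := (exitProb p w.age).toNNReal

theorem exitLaw_true_toReal (p : PMF ℕ) (w : Server) :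
    (exitLaw p w.age true).toReal = exitRate p w := by
  simp only [exitLaw, exitRate, PMF.ofFintype_apply, if_true]
  rfl

theorem exitLaw_add_toReal (p : PMF ℕ) (w : Server) :
    (exitLaw p w true).toReal + (exitLaw p w false).toReal = 1 := by
  rw [← ENNReal.toReal_add (PMF.apply_ne_top _ _) (PMF.apply_ne_top _ _)]
  simpa [tsum_fintype] using congrArg ENNReal.toReal (exitLaw p w).tsum_coe

theorem exitRate_le_one (p : PMF ℕ) (w : Server) : (exitRate p w : ℝ) ≤ 1 := by
  have h1 := exitLaw_add_toReal p w.age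
  rw [exitLaw_true_toReal] at h1
  linarith [ENNReal.toReal_nonneg (a := exitLaw p w.age false)]

/-- The transition law of one server: service, followed by Poisson arrivals of mean `r`. -/
def serverStep (p : PMF ℕ) (r : ℝ≥0) (w : Server) : PMF Server :=
  (exitStep p w.age).bind (arriveStep r)

/-- The aged server `w` after the departure, if `b` holds, and `n` arrivals. -/
def Server.update (w : Server) (b : Bool) (n : ℕ) : Server := (if b then w.depart else w).arrive n

theorem reroute_apply {M : ℕ} {ι : Type*} (ω : Fin M → Server) (d : Fin M → Bool)
    (r : Fin M → Fin M) (e : ι → Fin M) (k : ι) :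
    reroute ω d r (e k) = (ω (e k)).update (d (e k)) (arrivals e d r k) := rfl

open Classical in
theorem serverStep_apply_toReal (p : PMF ℕ) (r : ℝ≥0) (w y : Server) :
    (serverStep p r w y).toReal = ∑ b, (exitLaw p w.age b).toReal *
      ∑' n : ℕ, Real.exp (-r) * (r : ℝ) ^ n / n.factorial *
        (if w.age.update b n = y then 1 else 0) := by
  have hb : ∀ x : Server, |if x = y then (1 : ℝ) else 0| ≤ 1 := fun x => by split_ifs <;> simp
  have h1 : (serverStep p r w y).toReal =
      ∫ x, (if x = y then (1 : ℝ) else 0) ∂(serverStep p r w).toMeasure := by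
    rw [integral_toMeasure _ hb, tsum_eq_single y fun x hx => by simp [hx]]
    simp
  rw [h1, serverStep, integral_bind_toMeasure _ _ hb, exitStep, integral_map_toMeasure,
    PMF.integral_eq_sum]
  refine Finset.sum_congr rfl fun b _ => ?_
  rw [smul_eq_mul, arriveStep, integral_map_toMeasure, Measure.toPMF_toMeasure,
    integral_poissonMeasure]
  rfl

theorem integral_networkStep (p : PMF ℕ) {M : ℕ} (ω : Fin M → Server)
    {F : (Fin M → Server) → ℝ} {C : ℝ} (hF : ∀ x, |F x| ≤ C) :
    ∫ x, F x ∂(networkStep p ω).toMeasure =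
      ∑ d : Fin M → Bool, ∑ r : Fin M → Fin M,
        (∏ i, (exitLaw p (ω i).age (d i)).toReal / M) * F (reroute (fun i => (ω i).age) d r) := by
  rw [networkStep, integral_bind_toMeasure _ _ hF, PMF.integral_eq_sum]
  refine Finset.sum_congr rfl fun d _ => ?_
  rw [integral_map_toMeasure, PMF.integral_eq_sum, smul_eq_mul, Finset.mul_sum]
  refine Finset.sum_congr rfl fun r _ => ?_
  simp only [departures, PMF.ofFintype_apply, PMF.uniformOfFintype_apply, smul_eq_mul,
    Finset.prod_div_distrib, ENNReal.toReal_prod]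
  simp [div_eq_mul_inv, mul_assoc]

/-- The exit flow of a configuration of the network. -/
def meanExit (p : PMF ℕ) {M : ℕ} (ω : Fin M → Server) : ℝ≥0 := (∑ i, exitRate p (ω i)) / M

theorem meanExit_le_one (p : PMF ℕ) {M : ℕ} (ω : Fin M → Server) : (meanExit p ω : ℝ) ≤ 1 := by
  rw [meanExit, NNReal.coe_div, NNReal.coe_sum, NNReal.coe_natCast]
  refine div_le_one_of_le₀ ?_ (Nat.cast_nonneg _)
  exact (Finset.sum_le_card_nsmul _ _ 1 fun i _ => exitRate_le_one p _).trans (by simp)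

/-- The bound for the error of the Poisson approximation of one step at `K` of `M` servers. -/
def stepError (K M : ℕ) : ℝ :=
  2 ^ K * ((M * (2 * K / M) ^ 2 + K * (2 * K / M)) * Real.exp (2 * K))

theorem tendsto_stepError (K : ℕ) : Tendsto (stepError K) atTop (𝓝 0) := by
  have h : Tendsto (fun M : ℕ => 2 ^ K * (6 * (K : ℝ) ^ 2 * Real.exp (2 * K)) * (M : ℝ)⁻¹) atTop
      (𝓝 0) := by
    simpa using (tendsto_inv_atTop_nhds_zero_nat (𝕜 := ℝ)).const_mul
      (2 ^ K * (6 * (K : ℝ) ^ 2 * Real.exp (2 * K)))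
  refine h.congr' ?_
  filter_upwards [eventually_gt_atTop 0] with M hM
  have : (M : ℝ) ≠ 0 := by positivity
  rw [stepError]
  field_simp
  ring

open Classical in
/-- Seen from `K` servers, one step of the network is close, uniformly in the configuration, to
independent steps with Poisson arrivals of mean the exit flow of the configuration. The proof
conditions on the departures `δ` from these servers and applies Le Cam's bound. -/
theorem abs_integral_networkStep_sub_le (p : PMF ℕ) {M K : ℕ} [NeZero M] (hK : 2 * K ≤ M)
    (e : Fin K → Fin M) (he : Function.Injective e) (ω : Fin M → Server) (y : Fin K → Server) :
    |∫ x, (if (fun k => x (e k)) = y then (1 : ℝ) else 0) ∂(networkStep p ω).toMeasure -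
      ∏ k, (serverStep p (meanExit p ω) (ω (e k)) (y k)).toReal| ≤ stepError K M := by
  set l : Fin M → Bool → ℝ := fun i b => (exitLaw p (ω i).age b).toReal with hl
  set f : (Fin K → Bool) → Fin K → ℕ → ℝ := fun δ k n =>
    if (ω (e k)).age.update (δ k) n = y k then 1 else 0 with hf
  have hf1 : ∀ δ k n, |f δ k n| ≤ 1 := fun δ k n => by simp only [hf]; split_ifs <;> simp
  set m : (Fin K → Bool) → Fin M → Bool → ℝ := fun δ i b =>
    if ∀ k, e k = i → b = δ k then l i b else 0 with hm
  have hl0 : ∀ i b, 0 ≤ l i b := fun i b => ENNReal.toReal_nonneg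
  have hl1 : ∀ i, l i true + l i false = 1 := fun i => exitLaw_add_toReal p _
  have hlt : ∀ i, l i true = exitRate p (ω i) := fun i => exitLaw_true_toReal p _
  have hm0 : ∀ δ i b, 0 ≤ m δ i b := fun δ i b => by
    simp only [hm]; split_ifs; exacts [hl0 _ _, le_rfl]
  have hml : ∀ δ i b, m δ i b ≤ l i b := fun δ i b => by
    simp only [hm]; split_ifs; exacts [le_rfl, hl0 _ _]
  have hm1 : ∀ δ i, m δ i true + m δ i false ≤ 1 := fun δ i =>
    (add_le_add (hml _ _ _) (hml _ _ _)).trans_eq (hl1 i)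
  -- `m δ` is the law of the departures restricted to the event that those from the servers `e k`
  -- are given by `δ`: it differs from `l` only at these `K` servers.
  have hout : ∀ δ i, i ∉ Set.range e → m δ i = l i := fun δ i hi => by
    ext b
    exact if_pos fun k hk => absurd ⟨k, hk⟩ hi
  have hin : ∀ δ k, m δ (e k) true + m δ (e k) false = l (e k) (δ k) := fun δ k => by
    have : ∀ b, m δ (e k) b = if b = δ k then l (e k) b else 0 := fun b => by
      simp only [hm, he.eq_iff, forall_eq]
    rw [this, this]
    cases δ k <;> simp
  have hprod : ∀ δ, ∏ i, (m δ i true + m δ i false) = ∏ k, l (e k) (δ k) := fun δ =>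
    (Fintype.prod_of_injective e he _ _ (fun i hi => by rw [hout δ i hi, hl1])
      fun k => (hin δ k).symm).symm
  have hcond : ∀ δ (d : Fin M → Bool), ∏ i, m δ i (d i) / M =
      if (fun k => d (e k)) = δ then ∏ i, l i (d i) / M else 0 := fun δ d => by
    split_ifs with hd
    · refine Finset.prod_congr rfl fun i _ => ?_
      congr 1
      exact if_pos fun k hk => by rw [← hd, ← hk]
    · obtain ⟨k, hk⟩ := Function.ne_iff.1 hd
      refine Finset.prod_eq_zero (Finset.mem_univ (e k)) ?_
      simp only [hm]
      rw [if_neg fun h => hk (h k rfl), zero_div]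
  have hind : ∀ (d : Fin M → Bool) (r : Fin M → Fin M),
      (if (fun k => reroute (fun i => (ω i).age) d r (e k)) = y then (1 : ℝ) else 0) =
        ∏ k, f (fun k => d (e k)) k (arrivals e d r k) := fun d r => by
    simp only [reroute_apply, hf, Finset.prod_ite_zero, Finset.prod_const_one, funext_iff,
      Finset.mem_univ, true_implies]
  have hQ : ∫ x, (if (fun k => x (e k)) = y then (1 : ℝ) else 0) ∂(networkStep p ω).toMeasure =
      ∑ δ : Fin K → Bool, ∑ d : Fin M → Bool, ∑ r : Fin M → Fin M,
        (∏ i, m δ i (d i) / M) * evalAt (arrivals e d r) (prodFun (f δ) (hf1 δ)) := by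
    rw [integral_networkStep p ω (C := 1) fun x => by split_ifs <;> simp]
    symm
    rw [Finset.sum_comm]
    refine Finset.sum_congr rfl fun d _ => ?_
    rw [Finset.sum_comm]
    refine Finset.sum_congr rfl fun r _ => ?_
    simp only [hcond, hind, ite_mul, zero_mul, Finset.sum_ite_eq, Finset.mem_univ, if_true,
      evalAt_prodFun]
    rfl
  have hrate : (∑ i, (exitRate p (ω i) : ℝ)) / M = (meanExit p ω : ℝ) := by
    simp [meanExit]
  have hP : ∏ k, (serverStep p (meanExit p ω) (ω (e k)) (y k)).toReal =
      ∑ δ : Fin K → Bool, (∏ i, (m δ i true + m δ i false)) *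
        evalAt 0 (NormedSpace.exp (((∑ i, (exitRate p (ω i) : ℝ)) / M) • generator (Fin K))
          (prodFun (f δ) (hf1 δ))) := by
    simp_rw [serverStep_apply_toReal]
    rw [Finset.prod_univ_sum, Fintype.piFinset_univ]
    refine Finset.sum_congr rfl fun δ _ => ?_
    rw [hprod, exp_smul_generator_apply_zero, hrate, Finset.prod_mul_distrib]
  rw [hQ, hP, ← Finset.sum_sub_distrib]
  refine (Finset.abs_sum_le_sum_abs _ _).trans ((Finset.sum_le_card_nsmul _ _
    ((M * (2 * K / M : ℝ) ^ 2 + K * (2 * K / M)) * Real.exp (2 * K)) fun δ _ => ?_).trans_eq ?_)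
  · have hq0 : ∀ i, 0 ≤ (exitRate p (ω i) : ℝ) := fun i => NNReal.coe_nonneg _
    refine (abs_sum_arrivals_sub_le he (hm0 δ) (hm1 δ) hq0 (fun i => exitRate_le_one p (ω i))
      (by simpa using (Nat.cast_le (α := ℝ)).2 hK) _).trans ?_
    refine (mul_le_of_le_one_right ?_ (norm_prodFun_le _ _)).trans ?_
    · positivity
    · simp only [Fintype.card_fin]
      refine mul_le_mul_of_nonneg_right ?_ (Real.exp_nonneg _)
      rw [Finset.sum_add_distrib, ← Finset.sum_mul]
      refine add_le_add (le_of_eq (by simp)) (mul_le_mul_of_nonneg_right ?_ (by positivity))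
      have h0 : ∀ i, |m δ i true - (m δ i true + m δ i false) * exitRate p (ω i)| ≤
          if i ∈ Finset.univ.image e then 1 else 0 := fun i => by
        split_ifs with hi
        · have h1 := mul_nonneg (add_nonneg (hm0 δ i true) (hm0 δ i false)) (hq0 i)
          have h2 := mul_le_one₀ (hm1 δ i) (hq0 i) (exitRate_le_one p (ω i))
          exact abs_le.2 ⟨by linarith [hm0 δ i true], by
            linarith [hm0 δ i true, hm0 δ i false, hm1 δ i]⟩
        · rw [hout δ i (by simpa using hi), hl1, hlt]
          simp
      refine (Finset.sum_le_sum fun i _ => h0 i).trans ?_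
      rw [Finset.sum_ite_mem, Finset.univ_inter]
      simpa using Finset.card_image_le (s := Finset.univ) (f := e)
  · simp [stepError]

/-! ### Laws of trajectories and products -/

section Paths

theorem toProb_real_singleton {S : Type*} [MeasurableSpace S] [MeasurableSingletonClass S]
    (μ : PMF S) (x : S) : (toProb μ : Measure S).real {x} = (μ x).toReal :=
  toMeasure_real_singleton μ x

theorem prodLaw_real_singleton {S : Type*} [MeasurableSpace S] [MeasurableSingletonClass S]
    (K : ℕ) (μ : PMF S) (x : Fin K → S) :
    (prodLaw K μ : Measure (Fin K → S)).real {x} = ∏ k, (μ (x k)).toReal := by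
  rw [prodLaw, ProbabilityMeasure.toMeasure_pi, measureReal_def, Measure.pi_singleton,
    ENNReal.toReal_prod]
  exact Finset.prod_congr rfl fun k _ => toMeasure_real_singleton μ (x k)

theorem map_apply_toReal {S T : Type*} [Countable S] [MeasurableSpace S]
    [MeasurableSingletonClass S] [DecidableEq T] (μ : PMF S) (g : S → T) (y : T) :
    (μ.map g y).toReal = ∫ x, (if g x = y then 1 else 0) ∂μ.toMeasure := by
  rw [integral_toMeasure μ (C := 1) fun x => by split_ifs <;> simp, PMF.map_apply,
    ENNReal.tsum_toReal_eq fun x => by split_ifs <;> simp [PMF.apply_ne_top]]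
  refine tsum_congr fun x => ?_
  by_cases h : g x = y <;> simp [h, eq_comm (a := y)]

variable {S : Type*}

theorem pathLaw_succ_apply (ν : PMF S) (Q : ℕ → S → PMF S) (t : ℕ) (x : Fin (t + 1 + 1) → S) :
    pathLaw ν Q (t + 1) x =
      pathLaw ν Q t (Fin.init x) * Q t (Fin.init x (Fin.last t)) (x (Fin.last (t + 1))) := by
  classical
  rw [pathLaw, PMF.bind_apply, tsum_eq_single (Fin.init x), PMF.map_apply,
    tsum_eq_single (x (Fin.last (t + 1)))]
  · rw [if_pos (Fin.snoc_init_self x).symm]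
  · intro y hy
    refine if_neg fun h => hy ?_
    rw [h, Fin.snoc_last]
  · intro z hz
    rw [PMF.map_apply, ENNReal.tsum_eq_zero.2, mul_zero]
    refine fun y => if_neg fun h => hz ?_
    rw [h, Fin.init_snoc]

theorem pathLaw_succ_map_last (ν : PMF S) (Q : ℕ → S → PMF S) (t : ℕ) :
    (pathLaw ν Q (t + 1)).map (fun x => x (Fin.last (t + 1))) =
      ((pathLaw ν Q t).map fun x => x (Fin.last t)).bind (Q t) := by
  rw [pathLaw, PMF.map_bind, PMF.bind_map]
  congr 1
  funext x
  rw [PMF.map_comp, Function.comp_def]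
  simp only [Fin.snoc_last]
  exact PMF.map_id _

theorem pathLaw_network_map_last (p : PMF ℕ) {M : ℕ} (ν : PMF (Fin M → Server)) (t : ℕ) :
    (pathLaw ν (fun _ => networkStep p) t).map (fun x => x (Fin.last t)) = networkState p ν t := by
  induction t with
  | zero => rw [pathLaw, PMF.map_comp]; exact PMF.map_id ν
  | succ t ih => rw [pathLaw_succ_map_last, ih]; rfl

theorem nmpStep_eq (p : PMF ℕ) (μ : PMF Server) :
    nmpStep p μ = μ.bind (serverStep p (flow p μ)) := by
  rw [nmpStep, PMF.bind_map, PMF.bind_bind]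
  rfl

theorem pathLaw_nmp_map_last (p : PMF ℕ) (ν : PMF Server) (t : ℕ) :
    (pathLaw ν (nmpKernel p ν) t).map (fun x => x (Fin.last t)) = nmpState p ν t := by
  induction t with
  | zero => rw [pathLaw, PMF.map_comp]; exact PMF.map_id ν
  | succ t ih => rw [pathLaw_succ_map_last, ih, nmpState, nmpStep_eq]; rfl

/-- The exit flow of a state is the mean of the exit probabilities; both are finite, so that the
passage to real numbers loses nothing. -/
theorem flow_eq_integral (p : PMF ℕ) (μ : PMF Server) :
    (flow p μ : ℝ) = ∫ w, (exitRate p w : ℝ) ∂μ.toMeasure := by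
  have hne : ∀ w, exitProb p w ≠ ⊤ := fun w => ne_top_of_le_ne_top ENNReal.one_ne_top
    (exitProb_le_one p w)
  have hb : ∀ w, |(exitProb p w).toReal| ≤ 1 := fun w => by
    rw [abs_of_nonneg ENNReal.toReal_nonneg]
    exact ENNReal.toReal_le_of_le_ofReal zero_le_one (by simpa using exitProb_le_one p w)
  have h1 : ∫ w, (exitRate p w : ℝ) ∂μ.toMeasure =
      ∫ w, (exitProb p w).toReal ∂(μ.map Server.age).toMeasure :=
    (integral_map_toMeasure μ Server.age fun w => (exitProb p w).toReal).symm
  rw [h1, integral_toMeasure _ hb]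
  change (∑' w, (μ.map Server.age) w * exitProb p w).toReal = _
  rw [ENNReal.tsum_toReal_eq fun w => ENNReal.mul_ne_top (PMF.apply_ne_top _ _) (hne w)]
  simp_rw [ENNReal.toReal_mul]

theorem toProb_map {T : Type*} [Countable S] [MeasurableSpace S] [MeasurableSingletonClass S]
    [MeasurableSpace T] (μ : PMF S) (g : S → T) :
    toProb (μ.map g) =
      (toProb μ).map (f := g) Measurable.of_discrete.aemeasurable :=
  Subtype.ext (PMF.toMeasure_map (f := g) μ .of_discrete).symm

theorem prodLaw_map {T : Type*} [Countable S] [MeasurableSpace S] [MeasurableSingletonClass S]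
    [MeasurableSpace T] [Countable T] [MeasurableSingletonClass T] (K : ℕ) (μ : PMF S) (g : S → T) :
    prodLaw K (μ.map g) =
      (prodLaw K μ).map (f := fun x k => g (x k)) Measurable.of_discrete.aemeasurable := by
  apply Subtype.ext
  rw [prodLaw, toProb_map]
  exact (Measure.pi_map_pi (μ := fun _ : Fin K => μ.toMeasure) (f := fun _ => g)
    fun _ => Measurable.of_discrete.aemeasurable).symm

end Paths

/-! ### Dependence on the rate of the arrivals -/

/-- The numbers of arrivals can be read off from the new queue, so a transition probability is a
finite sum of Poisson weights. -/
theorem Server.update_injective (w : Server) (b : Bool) : Function.Injective (w.update b) := by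
  intro n n' h
  have := congrArg Server.queue h
  simpa [Server.update, Server.arrive, Server.queue] using this

theorem continuous_serverStep (p : PMF ℕ) (w y : Server) :
    Continuous fun r : ℝ≥0 => (serverStep p r w y).toReal := by
  classical
  simp_rw [serverStep_apply_toReal]
  refine continuous_finsetSum _ fun b _ => continuous_const.mul ?_
  by_cases h : ∃ n, w.age.update b n = y
  · obtain ⟨n, rfl⟩ := h
    have : ∀ r : ℝ≥0, ∑' n' : ℕ, Real.exp (-r) * (r : ℝ) ^ n' / n'.factorial *
        (if w.age.update b n' = w.age.update b n then (1 : ℝ) else 0) =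
        Real.exp (-r) * (r : ℝ) ^ n / n.factorial := fun r => by
      rw [tsum_eq_single n fun n' hn' => by
        rw [if_neg fun h => hn' (Server.update_injective _ _ h), mul_zero]]
      simp
    simp_rw [this]
    fun_prop
  · push Not at h
    simp [h, continuous_const]

/-- A continuous function with values in `[0, 1]` is near its value at a point up to a multiple of
the squared distance. -/
theorem exists_abs_sub_le_add_mul_sq {H : ℝ≥0 → ℝ} (hH : Continuous H) (h0 : ∀ r, 0 ≤ H r)
    (h1 : ∀ r, H r ≤ 1) (s : ℝ≥0) {ε : ℝ} (hε : 0 < ε) :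
    ∃ C, 0 ≤ C ∧ ∀ r : ℝ≥0, |H r - H s| ≤ ε + C * ((r : ℝ) - s) ^ 2 := by
  obtain ⟨δ, hδ, h⟩ := Metric.continuous_iff.1 hH s ε hε
  refine ⟨(δ ^ 2)⁻¹, by positivity, fun r => ?_⟩
  by_cases hr : dist r s < δ
  · have := (h r hr).le
    rw [Real.dist_eq] at this
    exact this.trans (le_add_of_nonneg_right (by positivity))
  · rw [not_lt, NNReal.dist_eq] at hr
    have h2 : δ ^ 2 ≤ ((r : ℝ) - s) ^ 2 := by
      rw [← sq_abs ((r : ℝ) - s)]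
      gcongr
    have h3 : 1 ≤ (δ ^ 2)⁻¹ * ((r : ℝ) - s) ^ 2 := by
      rw [inv_mul_eq_div]
      exact (one_le_div (by positivity)).2 h2
    have h4 : |H r - H s| ≤ 1 := abs_le.2 ⟨by linarith [h0 r, h1 s], by linarith [h0 s, h1 r]⟩
    linarith

/-! ### Propagation of chaos -/

section Chaos

variable {M : ℕ → ℕ}

/-- The choices of `K` distinct servers in one of the networks, as the size index `m` tends to
infinity: limits along this filter are uniform in the choice of the servers. -/
def choices (M : ℕ → ℕ) (K : ℕ) : Filter (Σ m, Fin K ↪ Fin (M m)) := comap Sigma.fst atTop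

/-- The joint law of the trajectories up to the time `t` of the `K` chosen servers. -/
def jointLaw (p : PMF ℕ) (νbar : ∀ m, PMF (Fin (M m) → Server)) (t K : ℕ)
    (z : Σ m, Fin K ↪ Fin (M m)) : ProbabilityMeasure (Fin K → Fin (t + 1) → Server) :=
  toProb ((pathLaw (νbar z.1) (fun _ => networkStep p) t).map fun x i s => x s (z.2 i))

/-- Chaos at time `t`: the trajectories of any `K` distinct servers are asymptotically independent,
with the law of the trajectory of the non-linear Markov process, uniformly in the choice of the
servers. -/
def Chaotic (p : PMF ℕ) (νbar : ∀ m, PMF (Fin (M m) → Server)) (ν : PMF Server) (t : ℕ) : Prop :=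
  ∀ K, Tendsto (jointLaw p νbar t K) (choices M K) (𝓝 (prodLaw K (pathLaw ν (nmpKernel p ν) t)))

variable {p : PMF ℕ} {νbar : ∀ m, PMF (Fin (M m) → Server)} {ν : PMF Server} {t : ℕ}

theorem integral_jointLaw {K : ℕ} (z : Σ m, Fin K ↪ Fin (M m))
    (f : (Fin K → Fin (t + 1) → Server) → ℝ) :
    ∫ x, f x ∂(jointLaw p νbar t K z : Measure (Fin K → Fin (t + 1) → Server)) =
      ∫ X, f (fun i s => X s (z.2 i))
        ∂(pathLaw (νbar z.1) (fun _ => networkStep p) t).toMeasure :=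
  integral_map_toMeasure _ _ _

theorem tendsto_fst_choices (K : ℕ) : Tendsto Sigma.fst (choices M K) atTop := tendsto_comap

open Classical in
theorem jointLaw_real_singleton {K : ℕ} (z : Σ m, Fin K ↪ Fin (M m))
    (x : Fin K → Fin (t + 1) → Server) :
    (jointLaw p νbar t K z : Measure (Fin K → Fin (t + 1) → Server)).real {x} =
      ∫ X, (if (fun i s => X s (z.2 i)) = x then 1 else 0)
        ∂(pathLaw (νbar z.1) (fun _ => networkStep p) t).toMeasure := by
  rw [jointLaw, toProb_real_singleton, map_apply_toReal]

/-- The law of large numbers for the exit flow, from the asymptotic independence of pairs. -/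
theorem Chaotic.tendsto_meanExit [∀ m, NeZero (M m)] (hM : Tendsto M atTop atTop)
    (h : Chaotic p νbar ν t) :
    Tendsto (fun m => ∫ X, ((meanExit p (X (Fin.last t)) : ℝ) - flow p (nmpState p ν t)) ^ 2
      ∂(pathLaw (νbar m) (fun _ => networkStep p) t).toMeasure) atTop (𝓝 0) := by
  set r : ℝ := NNReal.toReal (flow p (nmpState p ν t)) with hr
  set g : Server → ℝ := fun w => exitRate p w - r with hg
  have hrint : r = ∫ w, (exitRate p w : ℝ) ∂(nmpState p ν t).toMeasure := flow_eq_integral _ _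
  have hb0 : ∀ w, |(exitRate p w : ℝ)| ≤ 1 := fun w => by
    rw [abs_of_nonneg (NNReal.coe_nonneg _)]; exact exitRate_le_one p w
  have hr0 : 0 ≤ r := NNReal.coe_nonneg _
  have hr1 : r ≤ 1 := by
    rw [hrint]; exact (le_abs_self _).trans (abs_integral_toMeasure_le _ hb0)
  have hg1 : ∀ w, |g w| ≤ 1 := fun w => abs_le.2
    ⟨by linarith [NNReal.coe_nonneg (exitRate p w)], by linarith [exitRate_le_one p w]⟩
  have hgg : ∀ w w', |g w * g w'| ≤ 1 := fun w w' => by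
    rw [abs_mul]; exact mul_le_one₀ (hg1 w) (abs_nonneg _) (hg1 w')
  have hg0 : ∫ x, g (x (Fin.last t)) ∂(pathLaw ν (nmpKernel p ν) t).toMeasure = 0 := by
    rw [← integral_map_toMeasure _ (fun x : Fin (t + 1) → Server => x (Fin.last t)) g,
      pathLaw_nmp_map_last]
    simp only [hg]
    rw [integral_sub (integrable_of_bound _ hb0) (integrable_const _), ← hrint]
    simp
  have hpair := tendsto_integral_of_tendsto (h 2)
    (f := fun x => g (x 0 (Fin.last t)) * g (x 1 (Fin.last t))) (C := 1) fun x => hgg _ _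
  have hlim : ∫ x, g (x 0 (Fin.last t)) * g (x 1 (Fin.last t))
      ∂(prodLaw 2 (pathLaw ν (nmpKernel p ν) t) : Measure (Fin 2 → Fin (t + 1) → Server)) = 0 := by
    have := integral_fintype_prod_eq_prod (𝕜 := ℝ)
      (μ := fun _ : Fin 2 => (pathLaw ν (nmpKernel p ν) t).toMeasure)
      (fun _ x => g (x (Fin.last t)))
    simp only [Fin.prod_univ_two] at this
    refine this.trans ?_
    rw [hg0, zero_mul]
  rw [hlim] at hpair
  simp_rw [integral_jointLaw] at hpair
  rw [Metric.tendsto_atTop]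
  intro ε hε
  have h1 := Metric.tendsto_nhds.1 hpair (ε / 2) (half_pos hε)
  rw [choices, eventually_comap] at h1
  have hMinv : Tendsto (fun m => (M m : ℝ)⁻¹) atTop (𝓝 0) :=
    tendsto_inv_atTop_nhds_zero_nat.comp hM
  have h2 := hMinv.eventually_lt_const (half_pos hε)
  -- Chaos is uniform in the choice of servers, so `h1` holds for all pairs of distinct servers.
  obtain ⟨m₀, hm₀⟩ := eventually_atTop.1 (h1.and h2)
  refine ⟨m₀, fun m hm => ?_⟩
  obtain ⟨h1, h2⟩ := hm₀ m hm
  have hsq : ∀ X : Fin (t + 1) → Fin (M m) → Server,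
      (meanExit p (X (Fin.last t)) : ℝ) - r = (∑ i, g (X (Fin.last t) i)) / M m := fun X => by
    have hMpos : (0 : ℝ) < M m := Nat.cast_pos.2 (NeZero.pos _)
    simp [hg, meanExit, Finset.sum_sub_distrib]
    field_simp
  have hle := integral_sq_mean_le (pathLaw (νbar m) (fun _ => networkStep p) t).toMeasure
    (NeZero.pos (M m)) (g := fun i X => g (X (Fin.last t) i)) (fun i X => hg1 _) (half_pos hε).le
    fun i j hne => by
      have hinj : Function.Injective ![i, j] := injective_pair_iff_ne.2 hne
      have := h1 ⟨m, ⟨![i, j], hinj⟩⟩ rfl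
      rw [Real.dist_eq, sub_zero] at this
      exact (le_abs_self _).trans this.le
  simp_rw [hsq]
  rw [Real.dist_eq, sub_zero, abs_of_nonneg (integral_nonneg fun X => sq_nonneg _)]
  linarith

open Classical in
/-- Markov property: the trajectories of the chosen servers up to time `t + 1` are given by those
up to time `t` and by one step from the last configuration of the whole network. -/
theorem integral_pathLaw_succ_indicator {K : ℕ} (z : Σ m, Fin K ↪ Fin (M m))
    (x : Fin K → Fin (t + 1 + 1) → Server) :
    ∫ X, (if (fun i s => X s (z.2 i)) = x then (1 : ℝ) else 0)
        ∂(pathLaw (νbar z.1) (fun _ => networkStep p) (t + 1)).toMeasure =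
      ∫ X, (if (fun i s => X s (z.2 i)) = fun i => Fin.init (x i) then 1 else 0) *
          ∫ Y, (if (fun i => Y (z.2 i)) = fun i => x i (Fin.last (t + 1)) then 1 else 0)
            ∂(networkStep p (X (Fin.last t))).toMeasure
        ∂(pathLaw (νbar z.1) (fun _ => networkStep p) t).toMeasure := by
  rw [pathLaw, integral_bind_toMeasure _ _ (C := 1) fun x => by split_ifs <;> simp]
  refine integral_congr_ae (ae_of_all _ fun X => ?_)
  simp only
  rw [integral_map_toMeasure, ← integral_const_mul]
  refine integral_congr_ae (ae_of_all _ fun Y => ?_)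
  have : ((fun i s => (Fin.snoc X Y : Fin (t + 1 + 1) → Fin (M z.1) → Server) s (z.2 i)) = x) ↔
      ((fun i s => X s (z.2 i)) = fun i => Fin.init (x i)) ∧
        ((fun i => Y (z.2 i)) = fun i => x i (Fin.last (t + 1))) := by
    simp only [funext_iff, Fin.forall_fin_succ' (n := t + 1), Fin.snoc_castSucc, Fin.snoc_last,
      Fin.init, forall_and]
  simp only [this, ite_and, ite_mul, one_mul, zero_mul]

/-- Chaos propagates: given the past, one step at `K` servers is nearly a product of steps with
Poisson arrivals of mean the exit flow, which obeys the law of large numbers. -/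
theorem Chaotic.succ [∀ m, NeZero (M m)] (hM : Tendsto M atTop atTop) (h : Chaotic p νbar ν t) :
    Chaotic p νbar ν (t + 1) := by
  classical
  intro K
  rw [tendsto_iff_tendsto_singleton]
  intro x
  set x' : Fin K → Fin (t + 1) → Server := fun i => Fin.init (x i) with hx'
  set y : Fin K → Server := fun i => x i (Fin.last (t + 1)) with hy
  set r := flow p (nmpState p ν t) with hr
  set H : ℝ≥0 → ℝ := fun s => ∏ k, (serverStep p s (x' k (Fin.last t)) (y k)).toReal with hH
  have hHc : Continuous H := continuous_finsetProd _ fun k _ => continuous_serverStep p _ _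
  have hH0 : ∀ s, 0 ≤ H s := fun s => Finset.prod_nonneg fun k _ => ENNReal.toReal_nonneg
  have hle1 : ∀ (μ : PMF Server) w, (μ w).toReal ≤ 1 := fun μ w =>
    ENNReal.toReal_le_of_le_ofReal zero_le_one (by simpa using μ.coe_le_one w)
  have hH1 : ∀ s, H s ≤ 1 := fun s =>
    Finset.prod_le_one (fun k _ => ENNReal.toReal_nonneg) fun k _ => hle1 _ _
  have hold := tendsto_iff_tendsto_singleton.1 (h K) x'
  have hnew : (prodLaw K (pathLaw ν (nmpKernel p ν) (t + 1)) :
      Measure (Fin K → Fin (t + 1 + 1) → Server)).real {x} =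
      (prodLaw K (pathLaw ν (nmpKernel p ν) t) :
        Measure (Fin K → Fin (t + 1) → Server)).real {x'} * H r := by
    simp_rw [prodLaw_real_singleton, pathLaw_succ_apply, ENNReal.toReal_mul]
    rw [Finset.prod_mul_distrib]
    rfl
  rw [hnew]
  refine ((hold.mul_const (H r)).add (?_ : Tendsto (fun z => (jointLaw p νbar (t + 1) K z :
    Measure (Fin K → Fin (t + 1 + 1) → Server)).real {x} - (jointLaw p νbar t K z :
    Measure (Fin K → Fin (t + 1) → Server)).real {x'} * H r) (choices M K) (𝓝 0))).congr
      (fun z => by ring) |>.trans (by rw [add_zero])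
  rw [Metric.tendsto_nhds]
  intro ε hε
  obtain ⟨C, hC0, hC⟩ := exists_abs_sub_le_add_mul_sq hHc hH0 hH1 r (half_pos hε)
  have herr : Tendsto (fun m => stepError K (M m) + C *
      ∫ X, ((meanExit p (X (Fin.last t)) : ℝ) - r) ^ 2
        ∂(pathLaw (νbar m) (fun _ => networkStep p) t).toMeasure) atTop (𝓝 0) := by
    simpa using ((tendsto_stepError K).comp hM).add ((h.tendsto_meanExit hM).const_mul C)
  have hev := (tendsto_fst_choices (M := M) K).eventually
    ((herr.eventually_lt_const (half_pos hε)).and (hM.eventually_ge_atTop (2 * K)))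
  filter_upwards [hev] with z hz
  set I : (Fin (t + 1) → Fin (M z.1) → Server) → ℝ := fun X =>
    if (fun i s => X s (z.2 i)) = x' then 1 else 0 with hI
  set Q : (Fin (t + 1) → Fin (M z.1) → Server) → ℝ := fun X =>
    ∫ Y, (if (fun i => Y (z.2 i)) = y then 1 else 0)
      ∂(networkStep p (X (Fin.last t))).toMeasure with hQ
  have hI1 : ∀ X, |I X| ≤ 1 := fun X => by simp only [hI]; split_ifs <;> simp
  have hQ1 : ∀ X, |Q X| ≤ 1 := fun X =>
    abs_integral_toMeasure_le _ fun Y => by split_ifs <;> simp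
  have hIQ1 : ∀ X, |I X * Q X| ≤ 1 := fun X => by
    rw [abs_mul]; exact mul_le_one₀ (hI1 X) (abs_nonneg _) (hQ1 X)
  have hdiff1 : ∀ X, |I X * Q X - I X * H r| ≤ 1 + 1 := fun X => by
    refine (abs_sub _ _).trans (add_le_add (hIQ1 X) ?_)
    rw [abs_mul, abs_of_nonneg (hH0 r)]
    exact mul_le_one₀ (hI1 X) (hH0 r) (hH1 r)
  have hm1 : ∀ X : Fin (t + 1) → Fin (M z.1) → Server,
      |((meanExit p (X (Fin.last t)) : ℝ) - r) ^ 2| ≤ (1 + r) ^ 2 := fun X => by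
    have h1 := meanExit_le_one p (X (Fin.last t))
    have h2 := NNReal.coe_nonneg (meanExit p (X (Fin.last t)))
    have h3 := NNReal.coe_nonneg r
    rw [abs_of_nonneg (sq_nonneg _)]
    exact sq_le_sq' (by linarith) (by linarith)
  -- On the event `I`, the present states of the chosen servers are those prescribed by `x'`, so that
  -- the approximation of `Q X` depends on `X` only through the exit flow.
  have hdiff : ∀ X, |I X * Q X - I X * H r| ≤ stepError K (M z.1) + ε / 2 +
      C * ((meanExit p (X (Fin.last t)) : ℝ) - r) ^ 2 := fun X => by
    rw [add_assoc]
    have hstep := abs_integral_networkStep_sub_le p hz.2 z.2 z.2.injective (X (Fin.last t)) y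
    have hrate := hC (meanExit p (X (Fin.last t)))
    by_cases hX : (fun i s => X s (z.2 i)) = x'
    · have hlast : ∀ k, X (Fin.last t) (z.2 k) = x' k (Fin.last t) := fun k =>
        congrFun (congrFun hX k) (Fin.last t)
      simp only [hlast] at hstep
      simp only [hI, if_pos hX, one_mul]
      exact (abs_sub_le _ _ _).trans (add_le_add hstep hrate)
    · simp only [hI, if_neg hX, zero_mul, sub_zero, abs_zero]
      exact add_nonneg ((abs_nonneg _).trans hstep) ((abs_nonneg _).trans hrate)
  rw [Real.dist_eq, sub_zero, jointLaw_real_singleton, jointLaw_real_singleton,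
    integral_pathLaw_succ_indicator, ← integral_mul_const]
  rw [← integral_sub (integrable_of_bound _ hIQ1) ((integrable_of_bound _ hI1).mul_const _)]
  have := abs_integral_le_add_mul (pathLaw (νbar z.1) (fun _ => networkStep p) t).toMeasure
    hdiff1 hm1 hdiff
  linarith [hz.1]

end Chaos

/-! ### Chaos of the initial states -/

theorem continuous_real_singleton (w : Server) :
    Continuous fun μ : ProbabilityMeasure Server => (μ : Measure Server).real {w} :=
  continuous_iff_continuousAt.2 fun _ => tendsto_iff_tendsto_singleton.1 tendsto_id w

/-- The test function `μ ↦ ∏ k, μ {y k}` on probability measures. -/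
def prodMass {K : ℕ} (y : Fin K → Server) : ProbabilityMeasure Server →ᵇ ℝ :=
  BoundedContinuousFunction.ofNormedAddCommGroup
    (fun μ => ∏ k, (μ : Measure Server).real {y k})
    (continuous_finsetProd _ fun k _ => continuous_real_singleton (y k)) 1 fun μ => by
      rw [Real.norm_of_nonneg (Finset.prod_nonneg fun _ _ => measureReal_nonneg)]
      exact Finset.prod_le_one (fun _ _ => measureReal_nonneg) fun _ _ => measureReal_le_one

theorem prodMass_empirical {M K : ℕ} [NeZero M] (y : Fin K → Server) (ω : Fin M → Server) :
    prodMass y (empirical ω) =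
      ((M : ℝ) ^ K)⁻¹ * ∑ e : Fin K → Fin M, if (fun k => ω (e k)) = y then 1 else 0 := by
  have h1 : ∀ w, (empirical ω : Measure Server).real {w} =
      (M : ℝ)⁻¹ * ∑ i, if ω i = w then 1 else 0 := fun w => by
    change ((M : ℝ≥0∞)⁻¹ • ∑ i, Measure.dirac (ω i)).real {w} = _
    rw [measureReal_ennreal_smul_apply, measureReal_def, Measure.finsetSum_apply,
      ENNReal.toReal_sum fun i _ => measure_ne_top _ _]
    simp [Set.indicator_apply, apply_ite ENNReal.toReal]
  change ∏ k, (empirical ω : Measure Server).real {y k} = _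
  simp_rw [h1]
  rw [Finset.prod_mul_distrib, Finset.prod_const, Finset.card_univ, Fintype.card_fin, inv_pow,
    Finset.prod_univ_sum, Fintype.piFinset_univ]
  congr 1
  refine Finset.sum_congr rfl fun e _ => ?_
  simp [Finset.prod_ite_zero, funext_iff]

theorem tendsto_descFactorial_div_pow (K : ℕ) :
    Tendsto (fun M : ℕ => (M.descFactorial K : ℝ) / (M : ℝ) ^ K) atTop (𝓝 1) := by
  have h : Tendsto (fun M : ℕ => (1 - (K : ℝ) * (M : ℝ)⁻¹) ^ K) atTop (𝓝 1) := by
    have := ((tendsto_inv_atTop_nhds_zero_nat (𝕜 := ℝ)).const_mul (K : ℝ)).const_sub 1 |>.pow K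
    simpa using this
  refine tendsto_of_tendsto_of_tendsto_of_le_of_le' h tendsto_const_nhds ?_ ?_
  · filter_upwards [eventually_gt_atTop K] with M hM
    have hM0 : (0 : ℝ) < M := Nat.cast_pos.2 (by omega)
    have h1 : (1 - (K : ℝ) * (M : ℝ)⁻¹) = ((M - K : ℕ) : ℝ) / M := by
      rw [Nat.cast_sub hM.le]; field_simp
    rw [h1, div_pow]
    gcongr
    have h2 : (M - K) ^ K ≤ M.descFactorial K :=
      (Nat.pow_le_pow_left (by omega) K).trans (Nat.pow_sub_le_descFactorial M K)
    exact_mod_cast h2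
  · refine Eventually.of_forall fun M => div_le_one_of_le₀ ?_ (by positivity)
    exact_mod_cast Nat.descFactorial_le_pow M K

/-- Under an exchangeable law the configuration of any `K` distinct servers has nearly the mean of
the law of `K` independent draws from the empirical measure: the two differ by the draws with
repetitions. -/
theorem abs_integral_prodMass_sub_le {M K : ℕ} [NeZero M] {ν : PMF (Fin M → Server)}
    (hν : ServerSymmetric ν) (y : Fin K → Server) (e : Fin K ↪ Fin M) :
    |∫ ω, prodMass y (empirical ω) ∂ν.toMeasure -
        ∫ ω, (if (fun k => ω (e k)) = y then 1 else 0) ∂ν.toMeasure| ≤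
      1 - (M.descFactorial K : ℝ) / (M : ℝ) ^ K := by
  classical
  set J : (Fin K → Fin M) → ℝ := fun e =>
    ∫ ω, (if (fun k => ω (e k)) = y then 1 else 0) ∂ν.toMeasure with hJ
  have hind : ∀ (e : Fin K → Fin M) (ω : Fin M → Server),
      |if (fun k => ω (e k)) = y then (1 : ℝ) else 0| ≤ 1 := fun e ω => by split_ifs <;> simp
  have hJ0 : ∀ e, 0 ≤ J e := fun e => integral_nonneg fun ω => by
    change (0 : ℝ) ≤ if _ then 1 else 0
    split_ifs <;> simp
  have hJ1 : ∀ e, J e ≤ 1 := fun e =>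
    (le_abs_self _).trans (abs_integral_toMeasure_le _ (hind e))
  have hJe : ∀ e' : Fin K → Fin M, Function.Injective e' → J e' = J e := fun e' he' => by
    obtain ⟨σ, hσ⟩ := Equiv.Perm.exists_extending_pair e e' e.injective he'
    simp only [hJ]
    conv_rhs => rw [← hν σ, integral_map_toMeasure]
    simp only [hσ]
  have hM : (0 : ℝ) < (M : ℝ) ^ K := pow_pos (Nat.cast_pos.2 (NeZero.pos M)) K
  have hint : ∫ ω, prodMass y (empirical ω) ∂ν.toMeasure = ((M : ℝ) ^ K)⁻¹ * ∑ e', J e' := by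
    simp_rw [prodMass_empirical]
    rw [integral_const_mul, integral_finsetSum _ fun e' _ => integrable_of_bound _ (hind e')]
  have hcard : ∑ e' : Fin K → Fin M, (if Function.Injective e' then (1 : ℝ) else 0) =
      M.descFactorial K := by
    rw [Finset.sum_boole, ← Fintype.card_subtype,
      Fintype.card_congr (Equiv.subtypeInjectiveEquivEmbedding _ _), Fintype.card_embedding_eq,
      Fintype.card_fin, Fintype.card_fin]
  have hdiff : ((M : ℝ) ^ K)⁻¹ * ∑ e', J e' - J e = ((M : ℝ) ^ K)⁻¹ * ∑ e', (J e' - J e) := by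
    rw [Finset.sum_sub_distrib, mul_sub]
    simp only [Finset.sum_const, Finset.card_univ, Fintype.card_fun, Fintype.card_fin,
      nsmul_eq_mul, Nat.cast_pow]
    rw [inv_mul_cancel_left₀ hM.ne']
  have hterm : ∀ e', |J e' - J e| ≤ 1 - if Function.Injective e' then (1 : ℝ) else 0 := fun e' => by
    split_ifs with he'
    · rw [hJe e' he']; simp
    · exact abs_le.2 ⟨by linarith [hJ0 e', hJ1 e], by linarith [hJ1 e', hJ0 e]⟩
  change |_ - J e| ≤ _
  rw [hint, hdiff, abs_mul, abs_of_pos (inv_pos.2 hM)]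
  calc ((M : ℝ) ^ K)⁻¹ * |∑ e', (J e' - J e)|
      ≤ ((M : ℝ) ^ K)⁻¹ * ∑ e' : Fin K → Fin M,
          (1 - if Function.Injective e' then (1 : ℝ) else 0) := by
        gcongr
        exact (Finset.abs_sum_le_sum_abs _ _).trans (Finset.sum_le_sum fun e' _ => hterm e')
    _ = 1 - (M.descFactorial K : ℝ) / (M : ℝ) ^ K := by
        rw [Finset.sum_sub_distrib, hcard]
        simp only [Finset.sum_const, Finset.card_univ, Fintype.card_fun, Fintype.card_fin,
          nsmul_eq_mul, Nat.cast_pow, mul_one]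
        field_simp

/-- Symmetric initial states whose empirical measures obey the law of large numbers are chaotic. -/
theorem chaotic_zero {M : ℕ → ℕ} [∀ m, NeZero (M m)] (p : PMF ℕ) (hM : Tendsto M atTop atTop)
    {νbar : ∀ m, PMF (Fin (M m) → Server)} {ν : PMF Server}
    (hsymm : ∀ m, ServerSymmetric (νbar m)) (hLLN : EmpiricalLLN M νbar ν) :
    Chaotic p νbar ν 0 := by
  classical
  intro K
  rw [tendsto_iff_tendsto_singleton]
  intro x
  set y : Fin K → Server := fun k => x k 0 with hy
  have hconst : ∀ {S : Type} (a : S) (f : Fin (0 + 1) → S), ((fun _ => a) = f) ↔ a = f 0 :=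
    fun a f => ⟨fun h => congrFun h 0, fun h => funext fun s => by
      rw [h, Fin.fin_one_eq_zero s]⟩
  have hlim : (prodLaw K (pathLaw ν (nmpKernel p ν) 0) :
      Measure (Fin K → Fin (0 + 1) → Server)).real {x} = prodMass y (toProb ν) := by
    rw [prodLaw_real_singleton]
    refine Finset.prod_congr rfl fun k _ => ?_
    rw [toProb_real_singleton, pathLaw, map_apply_toReal]
    simp only [hconst]
    rw [← map_apply_toReal ν (fun a => a) (x k 0)]
    exact congrArg (fun μ : PMF Server => (μ (x k 0)).toReal) (PMF.map_id ν)
  have hmass : ∀ z : Σ m, Fin K ↪ Fin (M m), (jointLaw p νbar 0 K z :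
      Measure (Fin K → Fin (0 + 1) → Server)).real {x} =
      ∫ ω, (if (fun k => ω (z.2 k)) = y then 1 else 0) ∂(νbar z.1).toMeasure := fun z => by
    rw [jointLaw_real_singleton, pathLaw, integral_map_toMeasure]
    have : ∀ ω : Fin (M z.1) → Server, ((fun i (_ : Fin (0 + 1)) => ω (z.2 i)) = x) ↔
        (fun k => ω (z.2 k)) = y := fun ω => by
      rw [funext_iff, funext_iff]
      exact forall_congr' fun k => hconst _ _
    simp only [this]
  rw [hlim]
  simp_rw [hmass]
  have h1 := (hLLN (prodMass y)).comp (tendsto_fst_choices (M := M) K)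
  have h2 : Tendsto (fun z : Σ m, Fin K ↪ Fin (M m) =>
      1 - ((M z.1).descFactorial K : ℝ) / (M z.1 : ℝ) ^ K) (choices M K) (𝓝 0) := by
    simpa using ((tendsto_descFactorial_div_pow K).comp
      (hM.comp (tendsto_fst_choices (M := M) K))).const_sub 1
  have h3 := squeeze_zero_norm (f := fun z : Σ m, Fin K ↪ Fin (M m) =>
    ∫ ω, prodMass y (empirical ω) ∂(νbar z.1).toMeasure -
      ∫ ω, (if (fun k => ω (z.2 k)) = y then (1 : ℝ) else 0) ∂(νbar z.1).toMeasure)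
    (fun z : Σ m, Fin K ↪ Fin (M m) => abs_integral_prodMass_sub_le (hsymm z.1) y z.2) h2
  simpa using h1.sub h3

theorem chaotic {M : ℕ → ℕ} [∀ m, NeZero (M m)] (p : PMF ℕ) (hM : Tendsto M atTop atTop)
    {νbar : ∀ m, PMF (Fin (M m) → Server)} {ν : PMF Server}
    (hsymm : ∀ m, ServerSymmetric (νbar m)) (hLLN : EmpiricalLLN M νbar ν) (t : ℕ) :
    Chaotic p νbar ν t := by
  induction t with
  | zero => exact chaotic_zero p hM hsymm hLLN
  | succ t ih => exact ih.succ hM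

end

end ClosedNetwork

theorem theorem3 (p : PMF ℕ) (hp : p 0 = 0)
    (M N : ℕ → ℕ) [∀ m, NeZero (M m)] (ρ : ℝ)
    (hM : Tendsto M atTop atTop)
    (hN : Tendsto (fun m => (N m : ℝ) / (M m : ℝ)) atTop (𝓝 ρ))
    (νbar : ∀ m, PMF (Fin (M m) → Server))
    (hcust : ∀ m, ∀ ω ∈ (νbar m).support, ∑ i, (ω i).queue = N m)
    (hsymm : ∀ m, ServerSymmetric (νbar m))
    (ν : PMF Server) (hLLN : EmpiricalLLN M νbar ν)
    (K : ℕ) (hK : 1 ≤ K) (e : ∀ m, Fin K → Fin (M m))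
    (he : ∀ᶠ m in atTop, Function.Injective (e m)) (t : ℕ) :
    Tendsto (fun m => toProb ((networkState p (νbar m) t).map
          fun ω (i : Fin K) => ω (e m i))) atTop
        (𝓝 (prodLaw K (nmpState p ν t))) ∧
      Tendsto (fun m => toProb ((pathLaw (νbar m) (fun _ => networkStep p) t).map
          fun x (i : Fin K) (s : Fin (t + 1)) => x s (e m i))) atTop
        (𝓝 (prodLaw K (pathLaw ν (nmpKernel p ν) t))) := by
  have hpath : Tendsto (fun m => toProb ((pathLaw (νbar m) (fun _ => networkStep p) t).map
      fun x (i : Fin K) (s : Fin (t + 1)) => x s (e m i))) atTop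
      (𝓝 (prodLaw K (pathLaw ν (nmpKernel p ν) t))) := by
    intro U hU
    have hev := eventually_comap.1 (chaotic p hM hsymm hLLN t K hU)
    rw [mem_map]
    filter_upwards [hev, he] with m hm hinj
    exact hm ⟨m, ⟨e m, hinj⟩⟩ rfl
  refine ⟨?_, hpath⟩
  have hcont : Continuous fun (x : Fin K → Fin (t + 1) → Server) k => x k (Fin.last t) := by
    fun_prop
  have hmap := ProbabilityMeasure.tendsto_map_of_tendsto_of_continuous _ _ hpath hcont
  rw [← prodLaw_map K _ fun x : Fin (t + 1) → Server => x (Fin.last t),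
    pathLaw_nmp_map_last] at hmap
  refine hmap.congr fun m => ?_
  rw [← toProb_map, PMF.map_comp, ← pathLaw_network_map_last p (νbar m) t, PMF.map_comp]
  rfl
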